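/- Let $\mathbb T^3=\mathbb R^3/(2\mathbb Z)^3$ be the flat torus and let $\kappa$ be a constant (the conductivity of the base material). For a closed smooth two-sided surface $\omega$ embedded in $\mathbb T^3$, with unit normal field $\boldsymbol n$, let $A=|\omega|$ be its area, $\boldsymbol b$ its second fundamental form with respect to $\boldsymbol n$ (in a local parametrization $\boldsymbol r$, $b_{\alpha\beta}=\boldsymbol n\cdot\partial_\alpha\partial_\beta\boldsymbol r$), regarded as an operator on tangent vectors, $H=\tfrac12\operatorname{tr}\boldsymbol b$ its mean curvature, and $\boldsymbol I$ the identity. For $i=1,2,3$ let $\boldsymbol e^i_\omega$ be the tangential component along $\omega$ of the $i$-th canonical basis vector $\boldsymbol e^i$ of $\mathbb R^3$, and let $\bar u^i\in H^1(\omega)$ be a weak solution of $\Delta\bar u^i=-\operatorname{div}\boldsymbol e^i_\omega$ on $\omega$, i.e. $\int_\omega(\nabla\bar u^i+\boldsymbol e^i_\omega)\cdot\nabla w=0$ for all $w\in H^1(\omega)$. The asymptotic conductivity matrix (ADC matrix) of $\omega$ is $$k_A^{ij}=\frac{I_{ij}}{A},\qquad I_{ij}=\int_\omega\kappa\,(\nabla\bar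 u^i+\boldsymbol e^i_\omega)\cdot(\nabla\bar u^j+\boldsymbol e^j_\omega).$$ Let $\omega(t)$ be a smooth one-parameter family of closed surfaces embedded in $\mathbb T^3$, given by embeddings $\Phi_t$ of a fixed closed surface and defined for $t$ in an open set containing $t_0$, and suppose that at $t=t_0$ it moves with normal velocity $v_n$, i.e. $\partial_t\Phi_t|_{t=t_0}=v_n\boldsymbol n$ with $\boldsymbol n$ a continuous unit normal field of $\omega(t_0)$. Then $A$, $I_{ij}$ and $k_A^{ij}$ are differentiable in $t$ at $t_0$ and, with a dot denoting the derivative at $t_0$ and all integrals over $\omega=\omega(t_0)$, $$\dot k_A^{ij}=\frac{\dot I_{ij}}{A}-\frac{I_{ij}\,\dot A}{A^2},\qquad \dot A=-\int_\omega 2v_nH,$$ $$\dot I_{ij}=\int_\omega 2v_n\,\kappa\,(\boldsymbol b-H\boldsymbol I)(\nabla\bar u^i+\boldsymbol e^i_\omega)\cdot(\nabla\bar u^j+\boldsymbol e^j_\omega),\qquad i,j=1,2,3.$$ -/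

import Mathlib

open MeasureTheory Filter Topology Set
open scoped Manifold ContDiff ENNReal RealInnerProductSpace

noncomputable section

namespace ShellADC

/-- The parameter plane. -/
abbrev E2 : Type := EuclideanSpace ℝ (Fin 2)

/-- The ambient Euclidean space. -/
abbrev E3 : Type := EuclideanSpace ℝ (Fin 3)

/-- The flat torus `ℝ³ / (2ℤ)³`. -/
abbrev T3 : Type := Fin 3 → AddCircle (2 : ℝ)

instance factZeroLtTwo : Fact ((0 : ℝ) < 2) := ⟨two_pos⟩

/-- The quotient map `ℝ³ → ℝ³ / (2ℤ)³`. -/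
def torusProj (z : E3) : T3 := fun i => ((z i : ℝ) : AddCircle (2 : ℝ))

/-- The difference `p - q` of two points of the torus, represented in the fundamental domain
`(-1, 1]³`. For fixed `q` this is the inverse of `z ↦ q + torusProj z` near `q`, that is, the
flat coordinates of the torus centred at `q`. -/
def torusSub (p q : T3) : E3 :=
  WithLp.toLp 2 fun i => (AddCircle.equivIoc (2 : ℝ) (-1) (p i - q i) : ℝ)

section Surface

variable {M : Type*} [TopologicalSpace M] [ChartedSpace E2 M]

/-- The parametrization `r = φ ∘ e⁻¹` in the chart `e`, lifted to `ℝ³` near `e x` so that `x` is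
sent to the origin. -/
def lift (φ : M → T3) (e : OpenPartialHomeomorph M E2) (x : M) : E2 → E3 :=
  fun y => torusSub (φ (e.symm y)) (φ x)

/-- The covariant basis `a_α = ∂_α r` at `x`, in the chart `e`. -/
def covBasis (φ : M → T3) (e : OpenPartialHomeomorph M E2) (x : M) (α : Fin 2) : E3 :=
  fderiv ℝ (lift φ e x) (e x) (EuclideanSpace.single α 1)

/-- The first fundamental form `a_αβ = a_α · a_β`. -/
def metric (φ : M → T3) (e : OpenPartialHomeomorph M E2) (x : M) : Matrix (Fin 2) (Fin 2) ℝ :=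
  Matrix.of fun α β => ⟪covBasis φ e x α, covBasis φ e x β⟫

/-- The contravariant basis `a^α = a^{αβ} a_β`. -/
def contraBasis (φ : M → T3) (e : OpenPartialHomeomorph M E2) (x : M) (α : Fin 2) : E3 :=
  ∑ β, (metric φ e x)⁻¹ α β • covBasis φ e x β

/-- The second fundamental form `b_αβ = n · ∂_β a_α` for the normal field `n`. -/
def secondForm (φ : M → T3) (n : M → E3) (e : OpenPartialHomeomorph M E2) (x : M) :
    Matrix (Fin 2) (Fin 2) ℝ :=
  Matrix.of fun α β =>
    ⟪n x, fderiv ℝ (fun y => fderiv ℝ (lift φ e x) y (EuclideanSpace.single α 1)) (e x)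
      (EuclideanSpace.single β 1)⟫

/-- The density `√(det (a_αβ))` of the area in the chart `e`. -/
def areaDensity (φ : M → T3) (e : OpenPartialHomeomorph M E2) (x : M) : ℝ :=
  Real.sqrt (metric φ e x).det

/-! Pointwise quantities that do not depend on the chart are computed at `x` in the preferred
chart at `x`. -/

/-- The component `p_ω = (p · a_α) a^α` of `p` tangent to the surface at `x`. -/
def tangPart (φ : M → T3) (x : M) (p : E3) : E3 :=
  ∑ α, ⟪p, covBasis φ (chartAt E2 x) x α⟫ • contraBasis φ (chartAt E2 x) x α

/-- The mean curvature `H = (1/2) a^{αβ} b_αβ`. -/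
def meanCurv (φ : M → T3) (n : M → E3) (x : M) : ℝ :=
  (1 / 2) * ((metric φ (chartAt E2 x) x)⁻¹ * secondForm φ n (chartAt E2 x) x).trace

/-- The second fundamental form as an operator on tangent vectors, `b w = b_αβ w^β a^α` with
`w^β = w · a^β`. -/
def secondFormOp (φ : M → T3) (n : M → E3) (x : M) (w : E3) : E3 :=
  ∑ α, ∑ β, (secondForm φ n (chartAt E2 x) x α β * ⟪w, contraBasis φ (chartAt E2 x) x β⟫) •
    contraBasis φ (chartAt E2 x) x α

/-- `φ` is an injective immersion (its smoothness is stated separately); on a compact manifold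
it is then an embedding. -/
def IsEmbedded (φ : M → T3) : Prop :=
  Function.Injective φ ∧ ∀ x, LinearIndependent ℝ (covBasis φ (chartAt E2 x) x)

/-- `n` is a continuous field of unit normals along `φ`. -/
def IsUnitNormal (φ : M → T3) (n : M → E3) : Prop :=
  Continuous n ∧ ∀ x, ‖n x‖ = 1 ∧ ∀ α, ⟪covBasis φ (chartAt E2 x) x α, n x⟫ = 0

/-- `(t, x) ↦ Φ t x` is smooth on `J × M` as a map to the torus: it lifts locally to a smooth map
to `ℝ³`. -/
def IsSmoothFamily (Φ : ℝ → M → T3) (J : Set ℝ) : Prop :=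
  ∀ t ∈ J, ∀ x : M, ∃ N : Set (ℝ × M), IsOpen N ∧ (t, x) ∈ N ∧ ∃ F : ℝ × M → E3,
    ContMDiffOn (𝓘(ℝ, ℝ).prod 𝓘(ℝ, E2)) 𝓘(ℝ, E3) ∞ F N ∧
      ∀ z ∈ N, torusProj (F z) = Φ z.1 z.2

/-- A smooth evolution of embedded surfaces over the time set `J`. -/
def IsSurfaceEvolution (Φ : ℝ → M → T3) (J : Set ℝ) : Prop :=
  IsSmoothFamily Φ J ∧ ∀ t ∈ J, IsEmbedded (Φ t)

variable [IsManifold 𝓘(ℝ, E2) ∞ M] [CompactSpace M] [T2Space M]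

variable (M) in
/-- A smooth partition of unity, indexed by the points `c` of `M`, whose `c`-th function is
supported in the domain of the preferred chart at `c`. -/
def chartPartition : SmoothPartitionOfUnity M 𝓘(ℝ, E2) M univ :=
  (SmoothPartitionOfUnity.exists_isSubordinate_chartAt_source 𝓘(ℝ, E2) M).choose

variable [MeasurableSpace M] [BorelSpace M]

/-- The area measure of the surface: on the domain of each chart it is `√(det a) dy`, and these
local expressions are put together with a partition of unity (the result does not depend on
which one). -/
def areaMeasure (φ : M → T3) : Measure M :=
  Measure.sum fun c : M =>
    (((volume : Measure E2).restrict (chartAt E2 c).target).withDensity fun y =>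
      ENNReal.ofReal (chartPartition M c ((chartAt E2 c).symm y) *
        areaDensity φ (chartAt E2 c) ((chartAt E2 c).symm y))).map (chartAt E2 c).symm

/-- The area `A` of the surface. -/
def area (φ : M → T3) : ℝ := (areaMeasure φ).real univ

/-- `G` is the weak gradient on the surface of the function `u`, and `u` belongs to `H¹` of the
surface: `u` and `G` are square integrable, `G` is tangent, and in each chart the covariant
components `G · a_α` are the weak partial derivatives `∂_α u`. -/
structure HasH1Grad (φ : M → T3) (u : M → ℝ) (G : M → E3) : Prop where
  memLp_fun : MemLp u 2 (areaMeasure φ)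
  memLp_grad : MemLp G 2 (areaMeasure φ)
  tangent : ∀ᵐ x ∂(areaMeasure φ), tangPart φ x (G x) = G x
  weak : ∀ e ∈ atlas E2 M, ∀ α : Fin 2, ∀ η : E2 → ℝ, ContDiff ℝ ∞ η → HasCompactSupport η →
    tsupport η ⊆ e.target →
      ∫ y in e.target, u (e.symm y) * fderiv ℝ η y (EuclideanSpace.single α 1) =
        -∫ y in e.target, ⟪G (e.symm y), covBasis φ e (e.symm y) α⟫ * η y

/-- `u`, with gradient `G`, is a solution in `H¹` of `Δ u = -div p_ω` on the surface. -/
def IsCellSolution (φ : M → T3) (p : E3) (u : M → ℝ) (G : M → E3) : Prop :=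
  HasH1Grad φ u G ∧ ∀ (w : M → ℝ) (K : M → E3), HasH1Grad φ w K →
    ∫ x, ⟪G x + tangPart φ x p, K x⟫ ∂(areaMeasure φ) = 0

/-- The field `∇ uⁱ + eⁱ_ω`, where `G = ∇ uⁱ`. -/
def cellField (φ : M → T3) (G : M → E3) (i : Fin 3) (x : M) : E3 :=
  G x + tangPart φ x (EuclideanSpace.single i 1)

/-- The integral `I_ij = ∫ κ (∇ uⁱ + eⁱ_ω) · (∇ uʲ + eʲ_ω)`, where `G i = ∇ uⁱ`. -/
def adcIntegral (κ : ℝ) (φ : M → T3) (G : Fin 3 → M → E3) (i j : Fin 3) : ℝ :=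
  ∫ x, κ * ⟪cellField φ (G i) i x, cellField φ (G j) j x⟫ ∂(areaMeasure φ)

/-- The asymptotic conductivity matrix `k_A^{ij} = I_ij / A`. -/
def adcMatrix (κ : ℝ) (φ : M → T3) (G : Fin 3 → M → E3) : Matrix (Fin 3) (Fin 3) ℝ :=
  Matrix.of fun i j => (1 / area φ) * adcIntegral κ φ G i j

/-- The integrand `2 v κ (b - H I)(∇ uⁱ + eⁱ_ω) · (∇ uʲ + eʲ_ω)`. -/
def sensIntegrand (κ : ℝ) (φ : M → T3) (n : M → E3) (v : M → ℝ) (G : Fin 3 → M → E3)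
    (i j : Fin 3) (x : M) : ℝ :=
  2 * v x * κ *
    ⟪secondFormOp φ n x (cellField φ (G i) i x) - meanCurv φ n x • cellField φ (G i) i x,
      cellField φ (G j) j x⟫

end Surface

end ShellADC

end

open ShellADC

/-!
The coefficients `I_ij(t)` are the values of a quadratic form at the solutions of an elliptic
problem, so their derivative is the derivative of the form at the fixed solutions: the variation
of the solutions does not contribute. The proof compares increments, so that neither the existence
nor the regularity of a derivative of the solutions `uⁱ` in `t` is needed.

Everything is carried over to the surface `φ = Φ t₀`, on which a tangent field of `Φ t` is
represented by the tangent field with the same covariant components (`surfTransfer`). This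
identifies the `H¹` spaces of the two surfaces with their gradients (`HasH1Grad.transfer`), and
the energy on `Φ t` becomes `B_t(p, q) = ∫ ρ_t a^{αβ}(t) p_α q_β` on `φ`, where `ρ_t` is the ratio
of the area densities (`transferForm`, `integral_inner_eq_transferForm`). Let `Pⁱ` be the field
`∇ uⁱ + eⁱ` of `Φ t`, carried over to `φ`, and let `Qⁱ` be that of `φ`. The one-forms `dxⁱ`,
restricted to the two surfaces, differ by the differential of the `i`-th component of the
displacement, which is a single-valued function when `t` is close to `t₀`. So `Dⁱ = Pⁱ - Qⁱ` is
the gradient of a function in `H¹` (`hasH1Grad_cellField_sub`), and the cell equations give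
`B_t(Pⁱ, Dʲ) = 0` and `B_{t₀}(Qⁱ, Dʲ) = 0`, whence
`I_ij(t) - I_ij(t₀) = (B_t - B_{t₀})(Qⁱ, Qʲ) + (B_t - B_{t₀})(Dⁱ, Qʲ)`.

By compactness, `|B_t - B_{t₀}| ≤ K |t - t₀|` pointwise and uniformly (`exists_evolutionBound`).
With the two orthogonality relations this gives `‖D‖ = O(t - t₀)` (`integral_norm_sq_sub_le`), so
the last term is `O((t - t₀)²)`. In the first one, the integrand is differentiated pointwise: the
normal velocity `v n` gives `ȧ_αβ = -2 v b_αβ` (`hasDerivAt_metric`), and so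
`ρ̇ = -2 v H` and the derivative `2 v (b^{αβ} - H a^{αβ})` of the coefficients
(`hasDerivAt_areaRatio`, `hasDerivAt_transferForm`).

Since membership in `HasH1Grad` is expressed by Bochner integrals in charts, its linearity
requires that square integrable functions on the surface be locally integrable in every chart of
the atlas. This is `exists_map_symm_le_smul_areaMeasure`, by the change of variables formula.
-/

noncomputable section

set_option linter.unusedSectionVars false

namespace ShellADC

/-! ### Flat coordinates of the torus -/

lemma torusProj_add (z w : E3) : torusProj (z + w) = torusProj z + torusProj w := by
  funext i; simp [torusProj]

lemma torusProj_sub (z w : E3) : torusProj (z - w) = torusProj z - torusProj w := by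
  funext i; simp [torusProj]

lemma torusProj_torusSub (p q : T3) : torusProj (torusSub p q) = p - q := by
  funext i
  exact (AddCircle.equivIoc (2 : ℝ) (-1)).symm_apply_apply (p i - q i)

lemma torusSub_eq {p q : T3} {z : E3} (hz : ∀ i, z i ∈ Ioc (-1 : ℝ) 1)
    (h : torusProj z = p - q) : torusSub p q = z := by
  ext i
  have hi : p i - q i = ((z i : ℝ) : AddCircle (2 : ℝ)) := (congrFun h i).symm
  have hmem : z i ∈ Ioc (-1 : ℝ) (-1 + 2) := by
    have := hz i; norm_num at this ⊢; exact this
  show ((AddCircle.equivIoc (2 : ℝ) (-1) (p i - q i) : Ioc (-1 : ℝ) (-1 + 2)) : ℝ) = z i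
  rw [hi, (AddCircle.equivIoc (2 : ℝ) (-1)).eq_symm_apply.1
    (show ((z i : ℝ) : AddCircle (2 : ℝ)) =
      (AddCircle.equivIoc (2 : ℝ) (-1)).symm ⟨z i, hmem⟩ from rfl)]

lemma torusSub_eq_of_norm_lt {p q : T3} {z : E3} (hz : ‖z‖ < 1)
    (h : torusProj z = p - q) : torusSub p q = z := by
  refine torusSub_eq (fun i => ?_) h
  have := (abs_lt.1 ((Real.norm_eq_abs (z i) ▸ PiLp.norm_apply_le z i).trans_lt hz))
  exact ⟨this.1, this.2.le⟩

lemma torusSub_self (p : T3) : torusSub p p = 0 :=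
  torusSub_eq_of_norm_lt (by simp) (by funext i; simp [torusProj])

/-! ### Frames of tangent vectors and their dual frames -/

/-- The dual frame `a^α = a^{αβ} a_β` of the span of `a`, for a linearly independent `a`. -/
def dualFrame (a : Fin 2 → E3) (α : Fin 2) : E3 := ∑ β, (Matrix.gram ℝ a)⁻¹ α β • a β

/-- The operator `w ↦ (w · a_α) a'^α`, which turns the covariant components of `w` in the frame
`a` into those of a vector in the span of the frame `a'`. -/
def frameTransfer (a a' : Fin 2 → E3) : E3 →L[ℝ] E3 :=
  ∑ α, (innerSL ℝ (a α)).smulRight (dualFrame a' α)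

lemma frameTransfer_apply (a a' : Fin 2 → E3) (w : E3) :
    frameTransfer a a' w = ∑ α, ⟪w, a α⟫ • dualFrame a' α := by
  simp only [frameTransfer, _root_.sum_apply,
    ContinuousLinearMap.smulRight_apply, innerSL_apply_apply, real_inner_comm w]

lemma gram_symm (a : Fin 2 → E3) (α β : Fin 2) : Matrix.gram ℝ a α β = Matrix.gram ℝ a β α :=
  real_inner_comm (a β) (a α)

lemma gram_inv_symm (a : Fin 2 → E3) (α β : Fin 2) :
    (Matrix.gram ℝ a)⁻¹ α β = (Matrix.gram ℝ a)⁻¹ β α := by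
  have h : (Matrix.gram ℝ a).transpose = Matrix.gram ℝ a := by
    ext α β; exact gram_symm a β α
  have h2 := Matrix.transpose_nonsing_inv (Matrix.gram ℝ a)
  rw [h] at h2
  exact (congrFun (congrFun h2 α) β).symm

lemma gram_det_pos {a : Fin 2 → E3} (ha : LinearIndependent ℝ a) :
    0 < (Matrix.gram ℝ a).det :=
  (Matrix.posDef_gram_of_linearIndependent (𝕜 := ℝ) ha).det_pos

lemma inner_dualFrame {a : Fin 2 → E3} (ha : LinearIndependent ℝ a) (α β : Fin 2) :
    ⟪dualFrame a α, a β⟫ = if α = β then 1 else 0 := by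
  have h : ((Matrix.gram ℝ a)⁻¹ * Matrix.gram ℝ a) α β = (1 : Matrix (Fin 2) (Fin 2) ℝ) α β := by
    rw [Matrix.nonsing_inv_mul _ (gram_det_pos ha).ne'.isUnit]
  rw [Matrix.one_apply, Matrix.mul_apply] at h
  rw [← h, dualFrame, sum_inner]
  exact Finset.sum_congr rfl fun γ _ => real_inner_smul_left _ _ _

lemma inner_frameTransfer (a : Fin 2 → E3) {a' : Fin 2 → E3} (ha' : LinearIndependent ℝ a')
    (w : E3) (β : Fin 2) : ⟪frameTransfer a a' w, a' β⟫ = ⟪w, a β⟫ := by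
  rw [frameTransfer_apply, sum_inner]
  simp [real_inner_smul_left, inner_dualFrame ha']

lemma dualFrame_mem_span (a : Fin 2 → E3) (α : Fin 2) :
    dualFrame a α ∈ Submodule.span ℝ (range a) :=
  Submodule.sum_mem _ fun β _ => Submodule.smul_mem _ _ (Submodule.subset_span ⟨β, rfl⟩)

lemma frameTransfer_mem_span (a a' : Fin 2 → E3) (w : E3) :
    frameTransfer a a' w ∈ Submodule.span ℝ (range a') := by
  rw [frameTransfer_apply]
  exact Submodule.sum_mem _ fun β _ => Submodule.smul_mem _ _ (dualFrame_mem_span a' β)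

lemma eq_of_inner_frame_eq {a : Fin 2 → E3} {p q : E3} (hp : p ∈ Submodule.span ℝ (range a))
    (hq : q ∈ Submodule.span ℝ (range a)) (h : ∀ α, ⟪p, a α⟫ = ⟪q, a α⟫) : p = q := by
  have hd : p - q ∈ Submodule.span ℝ (range a) := Submodule.sub_mem _ hp hq
  have hz : ∀ r ∈ Submodule.span ℝ (range a), ⟪p - q, r⟫ = 0 := by
    intro r hr
    induction hr using Submodule.span_induction with
    | mem x hx => obtain ⟨α, rfl⟩ := hx; rw [inner_sub_left, h, sub_self]
    | zero => simp
    | add x y _ _ hx hy => rw [inner_add_right, hx, hy, add_zero]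
    | smul c x _ hx => rw [real_inner_smul_right, hx, mul_zero]
  exact sub_eq_zero.1 (inner_self_eq_zero.1 (hz _ hd))

lemma frameTransfer_comp (a : Fin 2 → E3) {a' : Fin 2 → E3} (ha' : LinearIndependent ℝ a')
    (a'' : Fin 2 → E3) (w : E3) :
    frameTransfer a' a'' (frameTransfer a a' w) = frameTransfer a a'' w := by
  rw [frameTransfer_apply a' a'', frameTransfer_apply a a'']
  simp_rw [inner_frameTransfer a ha']

lemma inner_frameTransfer_frameTransfer (a : Fin 2 → E3) {a' : Fin 2 → E3}
    (ha' : LinearIndependent ℝ a') (p q : E3) :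
    ⟪frameTransfer a a' p, frameTransfer a a' q⟫ =
      ∑ α, ∑ β, (Matrix.gram ℝ a')⁻¹ α β * ⟪p, a α⟫ * ⟪q, a β⟫ := by
  rw [frameTransfer_apply a a' p, sum_inner]
  refine Finset.sum_congr rfl fun α _ => ?_
  rw [real_inner_smul_left, dualFrame, sum_inner, Finset.mul_sum]
  refine Finset.sum_congr rfl fun β _ => ?_
  rw [real_inner_smul_left, real_inner_comm _ (a' β), inner_frameTransfer a ha']
  ring

/-! ### Change of frame -/

/-- The frame `b` written in terms of another one: `a_α = J_{βα} b_β`. -/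
def frameChange (J : Matrix (Fin 2) (Fin 2) ℝ) (b : Fin 2 → E3) (α : Fin 2) : E3 :=
  ∑ β, J β α • b β

lemma gram_frameChange (J : Matrix (Fin 2) (Fin 2) ℝ) (b : Fin 2 → E3) :
    Matrix.gram ℝ (frameChange J b) = J.transpose * Matrix.gram ℝ b * J := by
  ext α β
  simp only [Matrix.gram, frameChange, Matrix.of_apply, Matrix.mul_apply, Matrix.transpose_apply,
    Fin.sum_univ_two, inner_add_left, inner_add_right, real_inner_smul_left,
    real_inner_smul_right]
  ring

lemma gram_frameChange_det (J : Matrix (Fin 2) (Fin 2) ℝ) (b : Fin 2 → E3) :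
    (Matrix.gram ℝ (frameChange J b)).det = J.det ^ 2 * (Matrix.gram ℝ b).det := by
  rw [gram_frameChange, Matrix.det_mul, Matrix.det_mul, Matrix.det_transpose]
  ring

lemma linearIndependent_frameChange {J : Matrix (Fin 2) (Fin 2) ℝ} (hJ : J.det ≠ 0)
    {b : Fin 2 → E3} (hb : LinearIndependent ℝ b) : LinearIndependent ℝ (frameChange J b) := by
  apply Matrix.linearIndependent_of_det_gram_ne_zero (𝕜 := ℝ)
  rw [gram_frameChange_det]
  exact mul_ne_zero (pow_ne_zero 2 hJ) (gram_det_pos hb).ne'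

/-- The transfer operator does not depend on the chart in which the two frames are taken. -/
lemma frameTransfer_frameChange {J : Matrix (Fin 2) (Fin 2) ℝ} (hJ : J.det ≠ 0)
    (b : Fin 2 → E3) {b' : Fin 2 → E3} (hb' : LinearIndependent ℝ b') :
    frameTransfer (frameChange J b) (frameChange J b') = frameTransfer b b' := by
  have hLI := linearIndependent_frameChange hJ hb'
  have hle : Submodule.span ℝ (range (frameChange J b')) ≤ Submodule.span ℝ (range b') := by
    rw [Submodule.span_le]
    rintro _ ⟨α, rfl⟩
    exact Submodule.sum_mem _ fun β _ => Submodule.smul_mem _ _ (Submodule.subset_span ⟨β, rfl⟩)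
  have heq := Submodule.eq_of_le_of_finrank_eq hle
    (by rw [finrank_span_eq_card hLI, finrank_span_eq_card hb'])
  ext1 w
  refine eq_of_inner_frame_eq (frameTransfer_mem_span _ _ w)
    (heq ▸ frameTransfer_mem_span _ _ w) fun α => ?_
  rw [inner_frameTransfer _ hLI]
  simp only [frameChange, inner_sum, real_inner_smul_right, inner_frameTransfer b hb']

variable {M : Type*} [TopologicalSpace M] [ChartedSpace E2 M]

/-! ### Change of chart -/

/-- The Jacobian matrix at `x` of the change of coordinates from the chart `e` to `e'`; the column
index belongs to `e`. -/
def transitionJacobian (e e' : OpenPartialHomeomorph M E2) (x : M) :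
    Matrix (Fin 2) (Fin 2) ℝ :=
  Matrix.of fun β α => fderiv ℝ (e' ∘ e.symm) (e x) (EuclideanSpace.single α 1) β

lemma transitionJacobian_det (e e' : OpenPartialHomeomorph M E2) (x : M) :
    (transitionJacobian e e' x).det = (fderiv ℝ (e' ∘ e.symm) (e x)).det := by
  rw [ContinuousLinearMap.det,
    ← LinearMap.det_toMatrix (EuclideanSpace.basisFun (Fin 2) ℝ).toBasis]
  congr 1

section Manifold

variable [IsManifold 𝓘(ℝ, E2) ∞ M]

lemma contDiffAt_transition {e e' : OpenPartialHomeomorph M E2} (he : e ∈ atlas E2 M)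
    (he' : e' ∈ atlas E2 M) {x : M} (hx : x ∈ e.source) (hx' : x ∈ e'.source) :
    ContDiffAt ℝ ∞ (e' ∘ e.symm) (e x) := by
  have h1 : ContMDiffAt 𝓘(ℝ, E2) 𝓘(ℝ, E2) ∞ e.symm (e x) :=
    contMDiffAt_symm_of_mem_maximalAtlas (IsManifold.subset_maximalAtlas he) (e.map_source hx)
  have h2 : ContMDiffAt 𝓘(ℝ, E2) 𝓘(ℝ, E2) ∞ e' (e.symm (e x)) := by
    rw [e.left_inv hx]
    exact contMDiffAt_of_mem_maximalAtlas (IsManifold.subset_maximalAtlas he') hx'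
  exact (h2.comp _ h1).contDiffAt

lemma eventually_symm_mem_source {e e' : OpenPartialHomeomorph M E2} {x : M}
    (hx : x ∈ e.source) (hx' : x ∈ e'.source) :
    ∀ᶠ y in 𝓝 (e x), e.symm y ∈ e'.source := by
  have := e.continuousAt_symm (e.map_source hx)
  exact this (by rw [e.left_inv hx]; exact e'.open_source.mem_nhds hx')

lemma transitionJacobian_det_ne_zero {e e' : OpenPartialHomeomorph M E2}
    (he : e ∈ atlas E2 M) (he' : e' ∈ atlas E2 M) {x : M} (hx : x ∈ e.source)
    (hx' : x ∈ e'.source) : (transitionJacobian e e' x).det ≠ 0 := by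
  have h1 := ((contDiffAt_transition he he' hx hx').differentiableAt (by simp)).hasFDerivAt
  have h2 := ((contDiffAt_transition he' he hx' hx).differentiableAt (by simp)).hasFDerivAt
  have hpt : (e' ∘ e.symm) (e x) = e' x := by simp [e.left_inv hx]
  rw [← hpt] at h2
  have h3 := h2.comp (e x) h1
  have h4 : (e ∘ e'.symm) ∘ (e' ∘ e.symm) =ᶠ[𝓝 (e x)] id := by
    filter_upwards [eventually_symm_mem_source hx hx',
      e.open_target.mem_nhds (e.map_source hx)] with y hy hy'
    simp [e'.left_inv hy, e.right_inv hy']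
  have h5 := (h3.congr_of_eventuallyEq h4.symm).unique (hasFDerivAt_id (e x))
  rw [transitionJacobian_det]
  intro h0
  have h6 := congrArg ContinuousLinearMap.det h5
  rw [ContinuousLinearMap.det, ContinuousLinearMap.toLinearMap_comp, LinearMap.det_comp] at h6
  rw [ContinuousLinearMap.det] at h0
  rw [h0, mul_zero] at h6
  simp [ContinuousLinearMap.det] at h6

lemma lift_eventuallyEq_comp (φ : M → T3) {e e' : OpenPartialHomeomorph M E2} {x : M}
    (hx : x ∈ e.source) (hx' : x ∈ e'.source) :
    lift φ e x =ᶠ[𝓝 (e x)] lift φ e' x ∘ (e' ∘ e.symm) := by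
  filter_upwards [eventually_symm_mem_source hx hx'] with y hy
  simp [lift, e'.left_inv hy]

/-- The covariant bases in two charts differ by the Jacobian matrix. -/
lemma covBasis_eq_frameChange {φ : M → T3} {e e' : OpenPartialHomeomorph M E2}
    (he : e ∈ atlas E2 M) (he' : e' ∈ atlas E2 M) {x : M} (hx : x ∈ e.source)
    (hx' : x ∈ e'.source) (hφ : DifferentiableAt ℝ (lift φ e' x) (e' x)) :
    covBasis φ e x = frameChange (transitionJacobian e e' x) (covBasis φ e' x) := by
  have h1 := ((contDiffAt_transition he he' hx hx').differentiableAt (by simp)).hasFDerivAt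
  have hpt : (e' ∘ e.symm) (e x) = e' x := by simp [e.left_inv hx]
  have h2 := hφ.hasFDerivAt
  rw [← hpt] at h2
  have h3 := (h2.comp (e x) h1).congr_of_eventuallyEq (lift_eventuallyEq_comp φ hx hx')
  funext α
  rw [covBasis, h3.fderiv, ContinuousLinearMap.comp_apply, hpt]
  have hsum : fderiv ℝ (e' ∘ e.symm) (e x) (EuclideanSpace.single α 1) =
      ∑ β, transitionJacobian e e' x β α • EuclideanSpace.single β (1 : ℝ) := by
    ext γ
    fin_cases γ <;> simp [transitionJacobian]
  rw [hsum, map_sum]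
  simp only [map_smul, frameChange, covBasis]

end Manifold

lemma lift_self (φ : M → T3) {e : OpenPartialHomeomorph M E2} {x : M} (hx : x ∈ e.source) :
    lift φ e x (e x) = 0 := by
  rw [lift, e.left_inv hx, torusSub_self]

/-! ### Immersions of class `C¹` -/

/-- `φ` is an immersion of class `C¹`. The lift of `φ` near `x` is only required to be
differentiable at `x` itself, and the continuity of the derivative is stated for the covariant base
vectors as functions of `x`; this avoids lifts over a fixed neighbourhood. Linear independence in
the preferred charts implies it in all charts of the atlas. -/
structure IsImmersedC1 (φ : M → T3) : Prop where
  differentiableAt : ∀ e ∈ atlas E2 M, ∀ x ∈ e.source, DifferentiableAt ℝ (lift φ e x) (e x)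
  continuousOn_covBasis : ∀ e ∈ atlas E2 M, ∀ α, ContinuousOn (fun x => covBasis φ e x α) e.source
  linearIndependent_chartAt : ∀ x, LinearIndependent ℝ (covBasis φ (chartAt E2 x) x)

/-- The operator which sends a vector to the vector tangent to the surface `φ'` at `x` whose
covariant components are those of the given vector on the surface `φ`. -/
def surfTransfer (φ φ' : M → T3) (x : M) : E3 →L[ℝ] E3 :=
  frameTransfer (covBasis φ (chartAt E2 x) x) (covBasis φ' (chartAt E2 x) x)

lemma surfTransfer_self (φ : M → T3) (x : M) (p : E3) :
    surfTransfer φ φ x p = tangPart φ x p :=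
  frameTransfer_apply _ _ _

/-- The ratio at `x` of the area densities of the surfaces `φ'` and `φ`. -/
def areaRatio (φ φ' : M → T3) (x : M) : ℝ :=
  areaDensity φ' (chartAt E2 x) x / areaDensity φ (chartAt E2 x) x

namespace IsImmersedC1

variable [IsManifold 𝓘(ℝ, E2) ∞ M] {φ φ' φ'' : M → T3}

lemma covBasis_eq (hφ : IsImmersedC1 φ) {e e' : OpenPartialHomeomorph M E2}
    (he : e ∈ atlas E2 M) (he' : e' ∈ atlas E2 M) {x : M} (hx : x ∈ e.source)
    (hx' : x ∈ e'.source) :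
    covBasis φ e x = frameChange (transitionJacobian e e' x) (covBasis φ e' x) :=
  covBasis_eq_frameChange he he' hx hx' (hφ.differentiableAt e' he' x hx')

lemma linearIndependent (hφ : IsImmersedC1 φ) {e : OpenPartialHomeomorph M E2}
    (he : e ∈ atlas E2 M) {x : M} (hx : x ∈ e.source) :
    LinearIndependent ℝ (covBasis φ e x) := by
  rw [hφ.covBasis_eq he (chart_mem_atlas E2 x) hx (mem_chart_source E2 x)]
  exact linearIndependent_frameChange
    (transitionJacobian_det_ne_zero he (chart_mem_atlas E2 x) hx (mem_chart_source E2 x))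
    (hφ.linearIndependent_chartAt x)

lemma areaDensity_pos (hφ : IsImmersedC1 φ) {e : OpenPartialHomeomorph M E2}
    (he : e ∈ atlas E2 M) {x : M} (hx : x ∈ e.source) : 0 < areaDensity φ e x :=
  Real.sqrt_pos.2 (gram_det_pos (hφ.linearIndependent he hx))

lemma areaDensity_eq (hφ : IsImmersedC1 φ) {e e' : OpenPartialHomeomorph M E2}
    (he : e ∈ atlas E2 M) (he' : e' ∈ atlas E2 M) {x : M} (hx : x ∈ e.source)
    (hx' : x ∈ e'.source) :
    areaDensity φ e x = |(fderiv ℝ (e' ∘ e.symm) (e x)).det| * areaDensity φ e' x := by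
  show √(Matrix.gram ℝ (covBasis φ e x)).det = _ * √(Matrix.gram ℝ (covBasis φ e' x)).det
  rw [hφ.covBasis_eq he he' hx hx', gram_frameChange_det, Real.sqrt_mul (sq_nonneg _),
    Real.sqrt_sq_eq_abs, transitionJacobian_det]

lemma surfTransfer_eq (hφ : IsImmersedC1 φ) (hφ' : IsImmersedC1 φ')
    {e : OpenPartialHomeomorph M E2} (he : e ∈ atlas E2 M) {x : M} (hx : x ∈ e.source) :
    surfTransfer φ φ' x = frameTransfer (covBasis φ e x) (covBasis φ' e x) := by
  have hc := chart_mem_atlas E2 x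
  have hxc := mem_chart_source E2 x
  rw [surfTransfer, hφ.covBasis_eq he hc hx hxc, hφ'.covBasis_eq he hc hx hxc,
    frameTransfer_frameChange (transitionJacobian_det_ne_zero he hc hx hxc) _
      (hφ'.linearIndependent_chartAt x)]

lemma inner_surfTransfer (hφ : IsImmersedC1 φ) (hφ' : IsImmersedC1 φ')
    {e : OpenPartialHomeomorph M E2} (he : e ∈ atlas E2 M) {x : M} (hx : x ∈ e.source)
    (w : E3) (α : Fin 2) :
    ⟪surfTransfer φ φ' x w, covBasis φ' e x α⟫ = ⟪w, covBasis φ e x α⟫ := by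
  rw [hφ.surfTransfer_eq hφ' he hx, inner_frameTransfer _ (hφ'.linearIndependent he hx)]

lemma surfTransfer_surfTransfer (hφ' : IsImmersedC1 φ') (x : M) (w : E3) :
    surfTransfer φ' φ'' x (surfTransfer φ φ' x w) = surfTransfer φ φ'' x w :=
  frameTransfer_comp _ (hφ'.linearIndependent_chartAt x) _ _

lemma areaRatio_eq (hφ : IsImmersedC1 φ) (hφ' : IsImmersedC1 φ')
    {e : OpenPartialHomeomorph M E2} (he : e ∈ atlas E2 M) {x : M} (hx : x ∈ e.source) :
    areaRatio φ φ' x = areaDensity φ' e x / areaDensity φ e x := by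
  have hc := chart_mem_atlas E2 x
  have hxc := mem_chart_source E2 x
  rw [hφ.areaDensity_eq he hc hx hxc, hφ'.areaDensity_eq he hc hx hxc, areaRatio,
    mul_div_mul_left]
  rw [← transitionJacobian_det]
  exact abs_ne_zero.2 (transitionJacobian_det_ne_zero he hc hx hxc)

lemma areaRatio_pos (hφ : IsImmersedC1 φ) (hφ' : IsImmersedC1 φ') (x : M) :
    0 < areaRatio φ φ' x :=
  div_pos (hφ'.areaDensity_pos (chart_mem_atlas E2 x) (mem_chart_source E2 x))
    (hφ.areaDensity_pos (chart_mem_atlas E2 x) (mem_chart_source E2 x))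

lemma continuousOn_metric (hφ : IsImmersedC1 φ) {e : OpenPartialHomeomorph M E2}
    (he : e ∈ atlas E2 M) : ContinuousOn (fun x => metric φ e x) e.source := by
  refine continuousOn_pi.2 fun α => continuousOn_pi.2 fun β => ?_
  exact (hφ.continuousOn_covBasis e he α).inner (𝕜 := ℝ) (hφ.continuousOn_covBasis e he β)

lemma continuousOn_areaDensity (hφ : IsImmersedC1 φ) {e : OpenPartialHomeomorph M E2}
    (he : e ∈ atlas E2 M) : ContinuousOn (fun x => areaDensity φ e x) e.source :=
  (Continuous.matrix_det continuous_id).comp_continuousOn (hφ.continuousOn_metric he) |>.sqrt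

lemma continuousOn_dualFrame (hφ : IsImmersedC1 φ) {e : OpenPartialHomeomorph M E2}
    (he : e ∈ atlas E2 M) (α : Fin 2) :
    ContinuousOn (fun x => dualFrame (covBasis φ e x) α) e.source := by
  have hinv : ContinuousOn (fun x => (metric φ e x)⁻¹) e.source := by
    have hd : ContinuousOn (fun x => (metric φ e x).det) e.source :=
      (Continuous.matrix_det continuous_id).comp_continuousOn (hφ.continuousOn_metric he)
    have ha : ContinuousOn (fun x => (metric φ e x).adjugate) e.source :=
      (Continuous.matrix_adjugate continuous_id).comp_continuousOn (hφ.continuousOn_metric he)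
    simp_rw [Matrix.inv_def, Ring.inverse_eq_inv']
    exact (hd.inv₀ fun x hx => (gram_det_pos (hφ.linearIndependent he hx)).ne').smul ha
  refine continuousOn_finsetSum _ fun β _ => ?_
  exact ((continuousOn_pi.1 (continuousOn_pi.1 hinv α) β)).smul (hφ.continuousOn_covBasis e he β)

lemma continuous_surfTransfer (hφ : IsImmersedC1 φ) (hφ' : IsImmersedC1 φ') :
    Continuous (surfTransfer φ φ') := by
  refine continuous_iff_continuousAt.2 fun x₀ => ?_
  have he := chart_mem_atlas E2 x₀
  have hnhds := (chartAt E2 x₀).open_source.mem_nhds (mem_chart_source E2 x₀)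
  refine ContinuousAt.congr (f := fun x => frameTransfer (covBasis φ (chartAt E2 x₀) x)
    (covBasis φ' (chartAt E2 x₀) x)) ?_ ?_
  · refine ContinuousOn.continuousAt ?_ hnhds
    refine continuousOn_finsetSum _ fun α _ => ?_
    have h1 : ContinuousOn (fun x => innerSL ℝ (covBasis φ (chartAt E2 x₀) x α))
        (chartAt E2 x₀).source :=
      (innerSL ℝ).continuous.comp_continuousOn (hφ.continuousOn_covBasis _ he α)
    exact ((ContinuousLinearMap.smulRightL ℝ E3 E3).continuous.comp_continuousOn h1).clm_apply
      (hφ'.continuousOn_dualFrame he α)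
  · filter_upwards [hnhds] with x hx
    exact (hφ.surfTransfer_eq hφ' he hx).symm

lemma continuous_areaRatio (hφ : IsImmersedC1 φ) (hφ' : IsImmersedC1 φ') :
    Continuous (areaRatio φ φ') := by
  refine continuous_iff_continuousAt.2 fun x₀ => ?_
  have he := chart_mem_atlas E2 x₀
  have hnhds := (chartAt E2 x₀).open_source.mem_nhds (mem_chart_source E2 x₀)
  refine ContinuousAt.congr (f := fun x => areaDensity φ' (chartAt E2 x₀) x /
    areaDensity φ (chartAt E2 x₀) x) ?_ ?_
  · exact ((hφ'.continuousOn_areaDensity he).div (hφ.continuousOn_areaDensity he)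
      fun x hx => (hφ.areaDensity_pos he hx).ne').continuousAt hnhds
  · filter_upwards [hnhds] with x hx
    exact (hφ.areaRatio_eq hφ' he hx).symm

end IsImmersedC1

/-! ### Local lifts of a smooth family -/

/-- `F` is a smooth lift to `ℝ³` of the family `Φ` in the chart `e`, over the open set `W` of
times and coordinates. -/
structure IsLocalLift (Φ : ℝ → M → T3) (e : OpenPartialHomeomorph M E2) (W : Set (ℝ × E2))
    (F : ℝ × E2 → E3) : Prop where
  isOpen : IsOpen W
  mem_target : ∀ z ∈ W, z.2 ∈ e.target
  contDiffOn : ContDiffOn ℝ ∞ F W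
  proj : ∀ z ∈ W, torusProj (F z) = Φ z.1 (e.symm z.2)

lemma IsSmoothFamily.exists_isLocalLift [IsManifold 𝓘(ℝ, E2) ∞ M] {Φ : ℝ → M → T3} {J : Set ℝ}
    (hΦ : IsSmoothFamily Φ J) {e : OpenPartialHomeomorph M E2} (he : e ∈ atlas E2 M) {t : ℝ}
    (ht : t ∈ J) {x : M} (hx : x ∈ e.source) :
    ∃ W F, IsLocalLift Φ e W F ∧ (t, e x) ∈ W := by
  obtain ⟨N, hN, hmem, F, hF, hproj⟩ := hΦ t ht x
  have hg : ContMDiffOn 𝓘(ℝ, ℝ × E2) (𝓘(ℝ, ℝ).prod 𝓘(ℝ, E2)) ∞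
      (fun z : ℝ × E2 => (z.1, e.symm z.2)) (univ ×ˢ e.target) := by
    refine ContMDiffOn.prodMk ?_ ?_
    · exact contDiff_fst.contMDiff.contMDiffOn
    · have h1 : ContMDiffOn 𝓘(ℝ, E2) 𝓘(ℝ, E2) ∞ e.symm e.target :=
        contMDiffOn_symm_of_mem_maximalAtlas (IsManifold.subset_maximalAtlas he)
      exact h1.comp (contDiff_snd.contMDiff.contMDiffOn) fun z hz => hz.2
  have hcont := hg.continuousOn
  have hopen : IsOpen ((univ ×ˢ e.target) ∩ (fun z : ℝ × E2 => (z.1, e.symm z.2)) ⁻¹' N) :=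
    hcont.isOpen_inter_preimage (isOpen_univ.prod e.open_target) hN
  refine ⟨_, fun z => F (z.1, e.symm z.2), ⟨hopen, fun z hz => hz.1.2, ?_, ?_⟩, ?_⟩
  · have := hF.comp (hg.mono (inter_subset_left (t :=
      (fun z : ℝ × E2 => (z.1, e.symm z.2)) ⁻¹' N))) fun z hz => hz.2
    exact this.contDiffOn
  · exact fun z hz => hproj _ hz.2
  · exact ⟨⟨mem_univ _, e.map_source hx⟩, by simpa [e.left_inv hx] using hmem⟩

namespace IsLocalLift

variable {Φ : ℝ → M → T3} {e : OpenPartialHomeomorph M E2} {W : Set (ℝ × E2)} {F : ℝ × E2 → E3}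

lemma contDiffAt (h : IsLocalLift Φ e W F) {z : ℝ × E2} (hz : z ∈ W) : ContDiffAt ℝ ∞ F z :=
  h.contDiffOn.contDiffAt (h.isOpen.mem_nhds hz)

lemma contDiffAt_fderiv (h : IsLocalLift Φ e W F) {z : ℝ × E2} (hz : z ∈ W) :
    ContDiffAt ℝ ∞ (fderiv ℝ F) z :=
  (h.contDiffAt hz).fderiv_right (by simp)

lemma hasFDerivAt (h : IsLocalLift Φ e W F) {z : ℝ × E2} (hz : z ∈ W) :
    HasFDerivAt F (fderiv ℝ F z) z :=
  ((h.contDiffAt hz).differentiableAt (by simp)).hasFDerivAt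

lemma eventually_slice_mem (h : IsLocalLift Φ e W F) {z : ℝ × E2} (hz : z ∈ W) :
    ∀ᶠ y in 𝓝 z.2, (z.1, y) ∈ W :=
  (Continuous.prodMk_right z.1).continuousAt (h.isOpen.mem_nhds hz)

lemma lift_eventuallyEq (h : IsLocalLift Φ e W F) {z : ℝ × E2} (hz : z ∈ W) :
    lift (Φ z.1) e (e.symm z.2) =ᶠ[𝓝 z.2] fun y => F (z.1, y) - F z := by
  have hc : ContinuousAt (fun y => F (z.1, y) - F z) z.2 := by
    have h1 : ContinuousAt F (z.1, z.2) := (h.hasFDerivAt hz).continuousAt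
    exact (h1.comp (f := fun y => (z.1, y)) (Continuous.prodMk_right z.1).continuousAt).sub
      continuousAt_const
  have hs : ∀ᶠ y in 𝓝 z.2, ‖F (z.1, y) - F z‖ < 1 :=
    hc.norm.eventually_lt continuousAt_const (by simp)
  filter_upwards [hs, h.eventually_slice_mem hz] with y hy hyW
  exact torusSub_eq_of_norm_lt hy (by rw [torusProj_sub, h.proj _ hyW, h.proj _ hz])

lemma hasFDerivAt_slice (h : IsLocalLift Φ e W F) {z : ℝ × E2} (hz : z ∈ W) :
    HasFDerivAt (fun y => F (z.1, y)) ((fderiv ℝ F z).comp (ContinuousLinearMap.inr ℝ ℝ E2))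
      z.2 :=
  (h.hasFDerivAt hz).comp z.2 (hasFDerivAt_prodMk_right z.1 z.2)

lemma hasFDerivAt_lift (h : IsLocalLift Φ e W F) {z : ℝ × E2} (hz : z ∈ W) :
    HasFDerivAt (lift (Φ z.1) e (e.symm z.2))
      ((fderiv ℝ F z).comp (ContinuousLinearMap.inr ℝ ℝ E2)) z.2 :=
  ((h.hasFDerivAt_slice hz).sub_const _).congr_of_eventuallyEq (h.lift_eventuallyEq hz)

lemma covBasis_eq (h : IsLocalLift Φ e W F) {z : ℝ × E2} (hz : z ∈ W) (α : Fin 2) :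
    covBasis (Φ z.1) e (e.symm z.2) α = fderiv ℝ F z (0, EuclideanSpace.single α 1) := by
  rw [covBasis, e.right_inv (h.mem_target z hz), (h.hasFDerivAt_lift hz).fderiv]
  simp

lemma secondForm_eq (h : IsLocalLift Φ e W F) {z : ℝ × E2} (hz : z ∈ W) (n : M → E3)
    (α β : Fin 2) :
    secondForm (Φ z.1) n e (e.symm z.2) α β =
      ⟪n (e.symm z.2), fderiv ℝ (fderiv ℝ F) z (0, EuclideanSpace.single β 1)
        (0, EuclideanSpace.single α 1)⟫ := by
  rw [secondForm, Matrix.of_apply, e.right_inv (h.mem_target z hz)]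
  congr 1
  have h1 : (fun y => fderiv ℝ (lift (Φ z.1) e (e.symm z.2)) y (EuclideanSpace.single α 1))
      =ᶠ[𝓝 z.2] fun y => fderiv ℝ F (z.1, y) (0, EuclideanSpace.single α 1) := by
    filter_upwards [(h.lift_eventuallyEq hz).eventuallyEq_nhds, h.eventually_slice_mem hz]
      with y hy hyW
    rw [hy.fderiv_eq, ((h.hasFDerivAt_slice hyW).sub_const _).fderiv]
    simp
  have h2 : HasFDerivAt (fderiv ℝ F) (fderiv ℝ (fderiv ℝ F) z) (z.1, z.2) :=
    ((h.contDiffAt_fderiv hz).differentiableAt (by simp)).hasFDerivAt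
  have h3 := (h2.comp z.2 (hasFDerivAt_prodMk_right z.1 z.2)).clm_apply
    (hasFDerivAt_const (𝕜 := ℝ) ((0 : ℝ), EuclideanSpace.single α (1 : ℝ)) z.2)
  rw [(h3.congr_of_eventuallyEq h1).fderiv]
  simp

/-- For times near `t`, the displacement since the time `t` is the difference of the lifts: it is
too small to leave the fundamental domain of the torus. -/
lemma eventually_torusSub_eq (h : IsLocalLift Φ e W F) {t : ℝ} {y : E2} (hz : (t, y) ∈ W) :
    ∀ᶠ z : ℝ × E2 in 𝓝 (t, y), ‖F z - F (t, z.2)‖ < 1 / 2 ∧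
      torusSub (Φ z.1 (e.symm z.2)) (Φ t (e.symm z.2)) = F z - F (t, z.2) := by
  have hproj : ContinuousAt (fun z : ℝ × E2 => (t, z.2)) (t, y) := by fun_prop
  have hF : ContinuousAt F (t, y) := (h.hasFDerivAt hz).continuousAt
  have hc : ContinuousAt (fun z : ℝ × E2 => F z - F (t, z.2)) (t, y) :=
    hF.sub (ContinuousAt.comp (f := fun z : ℝ × E2 => (t, z.2)) (x := (t, y)) hF hproj)
  have hs : ∀ᶠ z : ℝ × E2 in 𝓝 (t, y), ‖F z - F (t, z.2)‖ < 1 / 2 :=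
    hc.norm.eventually_lt continuousAt_const (by simp)
  filter_upwards [hs, h.isOpen.mem_nhds hz, hproj (h.isOpen.mem_nhds hz)] with z h1 h2 h3
  refine ⟨h1, torusSub_eq_of_norm_lt (h1.trans (by norm_num)) ?_⟩
  rw [torusProj_sub, h.proj _ h2, h.proj _ h3]

end IsLocalLift

lemma IsSurfaceEvolution.isImmersedC1 [IsManifold 𝓘(ℝ, E2) ∞ M] {Φ : ℝ → M → T3} {J : Set ℝ}
    (hΦ : IsSurfaceEvolution Φ J) {t : ℝ} (ht : t ∈ J) : IsImmersedC1 (Φ t) where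
  differentiableAt e he x hx := by
    obtain ⟨W, F, h, hz⟩ := hΦ.1.exists_isLocalLift he ht hx
    have := (h.hasFDerivAt_lift hz).differentiableAt
    rwa [e.left_inv hx] at this
  continuousOn_covBasis e he α x hx := by
    obtain ⟨W, F, h, hz⟩ := hΦ.1.exists_isLocalLift he ht hx
    have hc : ContinuousAt (fun x => fderiv ℝ F (t, e x) (0, EuclideanSpace.single α 1)) x := by
      have h1 := (h.contDiffAt_fderiv hz).continuousAt
      have h2 : ContinuousAt (fun x => (t, e x)) x :=
        continuousAt_const.prodMk (e.continuousAt hx)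
      exact (ContinuousAt.comp (f := fun x => (t, e x)) h1 h2).clm_apply continuousAt_const
    refine (hc.congr ?_).continuousWithinAt
    have h2 : ContinuousAt (fun x => (t, e x)) x := continuousAt_const.prodMk (e.continuousAt hx)
    filter_upwards [h2 (h.isOpen.mem_nhds hz), e.open_source.mem_nhds hx] with x' hx' hs
    have := h.covBasis_eq (z := (t, e x')) hx' α
    rw [e.left_inv hs] at this
    exact this.symm
  linearIndependent_chartAt := (hΦ.2 t ht).2

/-! ### The displacement between two surfaces -/

/-- As long as two surfaces stay close, the displacement from one to the other is differentiable,
and its partial derivatives are the differences of the covariant base vectors. -/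
lemma hasFDerivAt_displacement {φ φ' : M → T3} {e : OpenPartialHomeomorph M E2} {x : M}
    (hx : x ∈ e.source) (hφ : DifferentiableAt ℝ (lift φ e x) (e x))
    (hφ' : DifferentiableAt ℝ (lift φ' e x) (e x)) (hsmall : ‖torusSub (φ' x) (φ x)‖ < 1) :
    HasFDerivAt (fun y => torusSub (φ' (e.symm y)) (φ (e.symm y)))
      (fderiv ℝ (lift φ' e x) (e x) - fderiv ℝ (lift φ e x) (e x)) (e x) := by
  have hd := ((hφ'.hasFDerivAt.sub hφ.hasFDerivAt).const_add (torusSub (φ' x) (φ x)))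
  refine hd.congr_of_eventuallyEq ?_
  have hs := hd.continuousAt.norm.eventually_lt (g := fun _ => (1 : ℝ)) continuousAt_const
    (by simpa [lift_self _ hx] using hsmall)
  filter_upwards [hs] with y hy
  refine torusSub_eq_of_norm_lt hy ?_
  simp only [Pi.sub_apply, torusProj_add, torusProj_sub, lift, torusProj_torusSub]
  abel

/-! ### The area measure -/

section AreaMeasure

variable [IsManifold 𝓘(ℝ, E2) ∞ M] [CompactSpace M] [T2Space M]

lemma tsupport_chartPartition_subset (c : M) :
    tsupport (chartPartition M c) ⊆ (chartAt E2 c).source :=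
  (SmoothPartitionOfUnity.exists_isSubordinate_chartAt_source 𝓘(ℝ, E2) M).choose_spec c

lemma chartPartition_finite : {c : M | (Function.support (chartPartition M c)).Nonempty}.Finite :=
  (chartPartition M).locallyFinite.finite_nonempty_of_compact

lemma sum_chartPartition (x : M) :
    ∑ c ∈ (chartPartition_finite (M := M)).toFinset, chartPartition M c x = 1 := by
  rw [← (chartPartition M).sum_eq_one (mem_univ x), finsum_eq_sum_of_support_subset]
  intro c hc
  simp only [Finite.coe_toFinset, Set.mem_ofPred_eq]
  exact ⟨x, hc⟩

namespace IsImmersedC1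

variable {φ φ' : M → T3}

lemma continuousOn_partition_mul_areaDensity (hφ : IsImmersedC1 φ) (c : M) :
    ContinuousOn (fun y => chartPartition M c ((chartAt E2 c).symm y) *
      areaDensity φ (chartAt E2 c) ((chartAt E2 c).symm y)) (chartAt E2 c).target := by
  have hs := (chartAt E2 c).continuousOn_symm
  exact ((chartPartition M c).contMDiff.continuous.comp_continuousOn hs).mul
    ((hφ.continuousOn_areaDensity (chart_mem_atlas E2 c)).comp hs
      fun y hy => (chartAt E2 c).map_target hy)

variable [MeasurableSpace M] [BorelSpace M]

lemma lintegral_areaMeasure (hφ : IsImmersedC1 φ) {h : M → ℝ≥0∞} (hh : Measurable h) :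
    ∫⁻ x, h x ∂(areaMeasure φ) = ∑' c : M, ∫⁻ y in (chartAt E2 c).target,
      ENNReal.ofReal (chartPartition M c ((chartAt E2 c).symm y) *
        areaDensity φ (chartAt E2 c) ((chartAt E2 c).symm y)) * h ((chartAt E2 c).symm y) := by
  rw [areaMeasure, lintegral_sum_measure]
  refine tsum_congr fun c => ?_
  have ht := (chartAt E2 c).open_target.measurableSet
  have hs : AEMeasurable (chartAt E2 c).symm
      ((volume : Measure E2).restrict (chartAt E2 c).target) :=
    (chartAt E2 c).continuousOn_symm.aemeasurable ht
  have hd := ((hφ.continuousOn_partition_mul_areaDensity c).aemeasurable (μ := volume)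
    ht).ennreal_ofReal
  rw [lintegral_map' hh.aemeasurable (hs.mono_ac (withDensity_absolutelyContinuous _ _))]
  exact lintegral_withDensity_eq_lintegral_mul₀ hd (hh.comp_aemeasurable hs)

/-- The area measures of two immersions of the same surface are mutually absolutely continuous,
with a continuous and positive density. -/
lemma areaMeasure_eq_withDensity (hφ : IsImmersedC1 φ) (hφ' : IsImmersedC1 φ') :
    areaMeasure φ' =
      (areaMeasure φ).withDensity fun x => ENNReal.ofReal (areaRatio φ φ' x) := by
  have hm : Measurable fun x => ENNReal.ofReal (areaRatio φ φ' x) :=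
    (hφ.continuous_areaRatio hφ').measurable.ennreal_ofReal
  refine Measure.ext_of_lintegral _ fun h hh => ?_
  rw [lintegral_withDensity_eq_lintegral_mul _ hm hh, hφ.lintegral_areaMeasure (hm.mul hh),
    hφ'.lintegral_areaMeasure hh]
  refine tsum_congr fun c => setLIntegral_congr_fun (chartAt E2 c).open_target.measurableSet
    fun y hy => ?_
  have hx := (chartAt E2 c).map_target hy
  have hc := chart_mem_atlas E2 c
  simp only [Pi.mul_apply]
  rw [← mul_assoc, hφ.areaRatio_eq hφ' hc hx, ← ENNReal.ofReal_mul
    (mul_nonneg ((chartPartition M).nonneg c _) (hφ.areaDensity_pos hc hx).le)]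
  congr 2
  field_simp [(hφ.areaDensity_pos hc hx).ne']

lemma isFiniteMeasure_areaMeasure (hφ : IsImmersedC1 φ) : IsFiniteMeasure (areaMeasure φ) := by
  constructor
  have h1 := hφ.lintegral_areaMeasure (h := fun _ => 1) measurable_const
  rw [lintegral_one] at h1
  rw [h1, tsum_eq_sum (s := (chartPartition_finite (M := M)).toFinset)]
  · refine ENNReal.sum_lt_top.2 fun c _ => ?_
    simp only [mul_one]
    have hK : IsCompact ((chartAt E2 c) '' tsupport (chartPartition M c)) :=
      (isClosed_tsupport _).isCompact.image_of_continuousOn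
        ((chartAt E2 c).continuousOn.mono (tsupport_chartPartition_subset c))
    have hKs : (chartAt E2 c) '' tsupport (chartPartition M c) ⊆ (chartAt E2 c).target := by
      rintro _ ⟨x, hx, rfl⟩
      exact (chartAt E2 c).map_source (tsupport_chartPartition_subset c hx)
    have hint := ((hφ.continuousOn_partition_mul_areaDensity c).mono hKs).integrableOn_compact
      (μ := volume) hK
    have hint' := hint.of_forall_sdiff_eq_zero (chartAt E2 c).open_target.measurableSet
      fun y hy => ?_
    · exact hint'.lintegral_lt_top
    · have h0 : chartPartition M c ((chartAt E2 c).symm y) = 0 :=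
        image_eq_zero_of_notMem_tsupport
          fun hmem => hy.2 ⟨_, hmem, (chartAt E2 c).right_inv hy.1⟩
      rw [h0, zero_mul]
  · intro c hc
    have hz : ∀ x, chartPartition M c x = 0 := by
      simpa [Set.Nonempty] using hc
    simp [hz]

/-- In any chart, the Lebesgue measure on a compact set of coordinates is dominated by the area
measure. -/
lemma exists_map_symm_le_smul_areaMeasure (hφ : IsImmersedC1 φ)
    {e : OpenPartialHomeomorph M E2} (he : e ∈ atlas E2 M) {K : Set E2} (hK : IsCompact K)
    (hKe : K ⊆ e.target) :
    ∃ C : ℝ, ((volume : Measure E2).restrict K).map e.symm ≤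
      ENNReal.ofReal C • areaMeasure φ := by
  have hcd : ContinuousOn (fun y => (areaDensity φ e (e.symm y))⁻¹) K :=
    ((hφ.continuousOn_areaDensity he).comp (e.continuousOn_symm.mono hKe)
      fun y hy => e.map_target (hKe hy)).inv₀
      fun y hy => (hφ.areaDensity_pos he (e.map_target (hKe hy))).ne'
  obtain ⟨C, hC⟩ := hK.exists_bound_of_continuousOn hcd
  have hsK : AEMeasurable e.symm ((volume : Measure E2).restrict K) :=
    (e.continuousOn_symm.mono hKe).aemeasurable hK.measurableSet
  refine ⟨C, Measure.le_iff.2 fun s hs => ?_⟩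
  set h : M → ℝ≥0∞ := s.indicator 1 with h_def
  have hh : Measurable h := measurable_one.indicator hs
  have hL : ((volume : Measure E2).restrict K).map e.symm s =
      ∫⁻ y in K, h (e.symm y) := by
    rw [← lintegral_map' hh.aemeasurable hsK, h_def, lintegral_indicator_one hs]
  have hR : (ENNReal.ofReal C • areaMeasure φ) s =
      ENNReal.ofReal C * ∫⁻ x, h x ∂(areaMeasure φ) := by
    rw [h_def, lintegral_indicator_one hs, Measure.smul_apply, smul_eq_mul]
  rw [hL, hR, hφ.lintegral_areaMeasure hh]
  set S := (chartPartition_finite (M := M)).toFinset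
  calc ∫⁻ y in K, h (e.symm y)
      = ∫⁻ y in K, ∑ c ∈ S, ENNReal.ofReal (chartPartition M c (e.symm y)) * h (e.symm y) := by
        refine lintegral_congr fun y => ?_
        rw [← Finset.sum_mul, ← ENNReal.ofReal_sum_of_nonneg
          fun c _ => (chartPartition M).nonneg c _, sum_chartPartition, ENNReal.ofReal_one, one_mul]
    _ = ∑ c ∈ S, ∫⁻ y in K,
          ENNReal.ofReal (chartPartition M c (e.symm y)) * h (e.symm y) := by
        refine lintegral_finsetSum' _ fun c _ => ?_
        exact ((chartPartition M c).contMDiff.continuous.measurable.comp_aemeasurable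
          hsK).ennreal_ofReal.mul (hh.comp_aemeasurable hsK)
    -- pass from `e` to the chart at `c`; the Jacobian is the ratio of the two area densities
    _ ≤ ∑ c ∈ S, ENNReal.ofReal C * ∫⁻ y in (chartAt E2 c).target,
          ENNReal.ofReal (chartPartition M c ((chartAt E2 c).symm y) *
            areaDensity φ (chartAt E2 c) ((chartAt E2 c).symm y)) *
              h ((chartAt E2 c).symm y) := by
        refine Finset.sum_le_sum fun c _ => ?_
        set d := chartAt E2 c
        have hd : d ∈ atlas E2 M := chart_mem_atlas E2 c
        set T : OpenPartialHomeomorph E2 E2 := d.symm.trans e with hT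
        have hTs : T.source ⊆ d.target := by
          rw [hT, OpenPartialHomeomorph.trans_source]; exact inter_subset_left
        set g : E2 → ℝ≥0∞ := K.indicator fun y =>
          ENNReal.ofReal (chartPartition M c (e.symm y)) * h (e.symm y)
        have hsrc : ∀ z ∈ T.source, z ∈ d.target ∧ d.symm z ∈ e.source := fun z hz => by
          simpa [hT, OpenPartialHomeomorph.trans_source] using hz
        have hder : ∀ z ∈ T.source,
            HasFDerivWithinAt T (fderiv ℝ (e ∘ d.symm) z) T.source z := fun z hz => by
          have h1 := contDiffAt_transition hd he (d.map_target (hsrc z hz).1) (hsrc z hz).2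
          rw [d.right_inv (hsrc z hz).1] at h1
          exact (h1.differentiableAt (by simp)).hasFDerivAt.hasFDerivWithinAt
        have hcv := lintegral_image_eq_lintegral_abs_det_fderiv_mul volume
          T.open_source.measurableSet hder T.injOn g
        rw [T.image_source_eq_target] at hcv
        calc ∫⁻ y in K, ENNReal.ofReal (chartPartition M c (e.symm y)) * h (e.symm y)
            = ∫⁻ y, g y := (lintegral_indicator hK.measurableSet _).symm
          _ = ∫⁻ y in T.target, g y := by
              refine (setLIntegral_eq_of_support_subset fun y hy => ?_).symm
              have hyK : y ∈ K := by
                by_contra hyK; exact hy (indicator_of_notMem hyK _)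
              have hne : chartPartition M c (e.symm y) ≠ 0 := by
                intro h0; apply hy; simp [g, h0]
              have h1 := tsupport_chartPartition_subset c (subset_tsupport _ hne)
              have : y ∈ T.symm.source := by
                simpa [hT, OpenPartialHomeomorph.trans_target] using ⟨hKe hyK, h1⟩
              exact this
          _ = ∫⁻ z in T.source,
                ENNReal.ofReal |(fderiv ℝ (e ∘ d.symm) z).det| * g (T z) := hcv
          _ ≤ ∫⁻ z in T.source, ENNReal.ofReal C * (ENNReal.ofReal
                (chartPartition M c (d.symm z) * areaDensity φ d (d.symm z)) *
                  h (d.symm z)) := by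
              refine setLIntegral_mono' T.open_source.measurableSet fun z hz => ?_
              by_cases hzK : T z ∈ K
              · obtain ⟨hz1, hz2⟩ := hsrc z hz
                have hTz : e.symm (T z) = d.symm z := by simp [hT, e.left_inv hz2]
                have hpos := hφ.areaDensity_pos he hz2
                have hbd := hC _ hzK
                rw [hTz, Real.norm_of_nonneg (inv_nonneg.2 hpos.le)] at hbd
                have hC0 : 0 ≤ C := (inv_nonneg.2 hpos.le).trans hbd
                have hde := hφ.areaDensity_eq hd he (d.map_target hz1) hz2
                rw [d.right_inv hz1] at hde
                simp only [g]
                rw [indicator_of_mem hzK, hTz, ← mul_assoc, ← mul_assoc,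
                  ← ENNReal.ofReal_mul (abs_nonneg _), ← ENNReal.ofReal_mul hC0]
                refine mul_le_mul' (ENNReal.ofReal_le_ofReal ?_) le_rfl
                rw [hde]
                have hp := (chartPartition M).nonneg c (d.symm z)
                have h1 : 1 ≤ C * areaDensity φ e (d.symm z) := by
                  rw [← inv_mul_cancel₀ hpos.ne']; gcongr
                calc _ ≤ (|(fderiv ℝ (e ∘ d.symm) z).det| * chartPartition M c (d.symm z)) *
                      (C * areaDensity φ e (d.symm z)) :=
                      le_mul_of_one_le_right (by positivity) h1
                  _ = _ := by ring
              · simp [g, hzK]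
          _ ≤ ∫⁻ z in d.target, ENNReal.ofReal C * (ENNReal.ofReal
                (chartPartition M c (d.symm z) * areaDensity φ d (d.symm z)) *
                  h (d.symm z)) := lintegral_mono_set hTs
          _ = _ := lintegral_const_mul' _ _ ENNReal.ofReal_ne_top
    _ = ENNReal.ofReal C * ∑ c ∈ S, ∫⁻ y in (chartAt E2 c).target,
          ENNReal.ofReal (chartPartition M c ((chartAt E2 c).symm y) *
            areaDensity φ (chartAt E2 c) ((chartAt E2 c).symm y)) *
              h ((chartAt E2 c).symm y) := by rw [Finset.mul_sum]
    _ ≤ _ := by gcongr; exact ENNReal.sum_le_tsum _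

end IsImmersedC1

end AreaMeasure

/-! ### The Sobolev space `H¹` of the surface -/

lemma fderiv_apply_eq_zero_of_notMem_tsupport {η : E2 → ℝ} {y : E2} (hy : y ∉ tsupport η)
    (v : E2) : fderiv ℝ η y v = 0 := by
  have : fderiv ℝ η y = 0 :=
    image_eq_zero_of_notMem_tsupport fun h => hy (tsupport_fderiv_subset ℝ h)
  rw [this]; rfl

section Sobolev

variable [IsManifold 𝓘(ℝ, E2) ∞ M] [CompactSpace M] [T2Space M] [MeasurableSpace M]
  [BorelSpace M] {φ φ' : M → T3}

namespace IsImmersedC1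

lemma exists_areaMeasure_le_smul (hφ : IsImmersedC1 φ) (hφ' : IsImmersedC1 φ') :
    ∃ C : ℝ, areaMeasure φ' ≤ ENNReal.ofReal C • areaMeasure φ := by
  obtain ⟨C, hC⟩ := isCompact_univ.exists_bound_of_continuousOn
    (hφ.continuous_areaRatio hφ').continuousOn
  refine ⟨C, ?_⟩
  rw [hφ.areaMeasure_eq_withDensity hφ', ← withDensity_const]
  refine withDensity_mono (Eventually.of_forall fun x => ENNReal.ofReal_le_ofReal ?_)
  exact (le_abs_self _).trans (hC x (mem_univ x))

lemma memLp_areaMeasure_of_memLp (hφ : IsImmersedC1 φ) (hφ' : IsImmersedC1 φ')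
    {F : Type*} [NormedAddCommGroup F] {f : M → F} {p : ℝ≥0∞}
    (hf : MemLp f p (areaMeasure φ)) : MemLp f p (areaMeasure φ') := by
  obtain ⟨C, hC⟩ := hφ.exists_areaMeasure_le_smul hφ'
  exact hf.of_measure_le_smul ENNReal.ofReal_ne_top hC

/-- Transfer operators preserve square integrability. -/
lemma memLp_surfTransfer {φ₁ φ₂ : M → T3} (h₁ : IsImmersedC1 φ₁) (h₂ : IsImmersedC1 φ₂)
    {μ : Measure M} {p : ℝ≥0∞} {G : M → E3} (hG : MemLp G p μ) :
    MemLp (fun x => surfTransfer φ₁ φ₂ x (G x)) p μ := by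
  have hc := h₁.continuous_surfTransfer h₂
  obtain ⟨C, hC⟩ := isCompact_univ.exists_bound_of_continuousOn hc.continuousOn
  refine hG.of_le_mul (c := C) ?_ (Eventually.of_forall fun x => ?_)
  · exact (ContinuousLinearMap.id ℝ (E3 →L[ℝ] E3)).aestronglyMeasurable_comp₂
      hc.aestronglyMeasurable hG.1
  · exact (ContinuousLinearMap.le_opNorm _ _).trans (by gcongr; exact hC x (mem_univ x))

lemma memLp_tangPart (hφ : IsImmersedC1 φ) {μ : Measure M} [IsFiniteMeasure μ] {p : ℝ≥0∞}
    (w : E3) : MemLp (fun x => tangPart φ x w) p μ := by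
  simp_rw [← surfTransfer_self]
  exact hφ.memLp_surfTransfer hφ (memLp_const w)

lemma integrableOn_comp_symm (hφ : IsImmersedC1 φ) {e : OpenPartialHomeomorph M E2}
    (he : e ∈ atlas E2 M) {K : Set E2} (hK : IsCompact K) (hKe : K ⊆ e.target)
    {F : Type*} [NormedAddCommGroup F] {f : M → F} (hf : Integrable f (areaMeasure φ)) :
    IntegrableOn (fun y => f (e.symm y)) K := by
  obtain ⟨C, hC⟩ := hφ.exists_map_symm_le_smul_areaMeasure he hK hKe
  have hm : AEMeasurable e.symm ((volume : Measure E2).restrict K) :=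
    (e.continuousOn_symm.mono hKe).aemeasurable hK.measurableSet
  exact (hf.of_measure_le_smul ENNReal.ofReal_ne_top hC).comp_aemeasurable hm

lemma integrableOn_mul_fderiv (hφ : IsImmersedC1 φ) {e : OpenPartialHomeomorph M E2}
    (he : e ∈ atlas E2 M) {u : M → ℝ} (hu : Integrable u (areaMeasure φ)) {η : E2 → ℝ}
    (hη : ContDiff ℝ ∞ η) (hs : HasCompactSupport η) (hse : tsupport η ⊆ e.target) (v : E2) :
    IntegrableOn (fun y => u (e.symm y) * fderiv ℝ η y v) e.target := by
  have h1 := (hφ.integrableOn_comp_symm he hs hse hu).mul_continuousOn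
    (g' := fun y => fderiv ℝ η y v)
    ((hη.continuous_fderiv (by simp)).clm_apply continuous_const).continuousOn hs
  refine h1.of_forall_sdiff_eq_zero e.open_target.measurableSet fun y hy => ?_
  rw [fderiv_apply_eq_zero_of_notMem_tsupport hy.2, mul_zero]

lemma integrableOn_inner_covBasis_mul (hφ : IsImmersedC1 φ) {e : OpenPartialHomeomorph M E2}
    (he : e ∈ atlas E2 M) {G : M → E3} (hG : Integrable G (areaMeasure φ)) {η : E2 → ℝ}
    (hη : ContDiff ℝ ∞ η) (hs : HasCompactSupport η) (hse : tsupport η ⊆ e.target) (α : Fin 2) :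
    IntegrableOn (fun y => ⟪G (e.symm y), covBasis φ e (e.symm y) α⟫ * η y) e.target := by
  have hcov : ContinuousOn (fun y => covBasis φ e (e.symm y) α) (tsupport η) :=
    (hφ.continuousOn_covBasis e he α).comp (e.continuousOn_symm.mono hse)
      fun y hy => e.map_target (hse hy)
  have h1 : IntegrableOn (fun y => ∑ k : Fin 3, G (e.symm y) k *
      (covBasis φ e (e.symm y) α k * η y)) (tsupport η) := by
    refine integrable_finsetSum _ fun k _ => ?_
    refine IntegrableOn.mul_continuousOn (g := fun y => G (e.symm y) k) ?_ ?_ hs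
    · exact (EuclideanSpace.proj (𝕜 := ℝ) k).integrable_comp
        (hφ.integrableOn_comp_symm he hs hse hG)
    · exact ((EuclideanSpace.proj (𝕜 := ℝ) k).continuous.comp_continuousOn hcov).mul
        hη.continuous.continuousOn
  have h2 : (fun y => ⟪G (e.symm y), covBasis φ e (e.symm y) α⟫ * η y) =
      fun y => ∑ k : Fin 3, G (e.symm y) k * (covBasis φ e (e.symm y) α k * η y) := by
    funext y
    rw [PiLp.inner_apply, Finset.sum_mul]
    refine Finset.sum_congr rfl fun k _ => ?_
    simp only [RCLike.inner_apply, conj_trivial]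
    ring
  rw [h2]
  refine h1.of_forall_sdiff_eq_zero e.open_target.measurableSet fun y hy => ?_
  simp [image_eq_zero_of_notMem_tsupport hy.2]

end IsImmersedC1

namespace HasH1Grad

variable {u u' : M → ℝ} {G G' : M → E3}

lemma sub (hφ : IsImmersedC1 φ) (h : HasH1Grad φ u G) (h' : HasH1Grad φ u' G') :
    HasH1Grad φ (u - u') (G - G') where
  memLp_fun := h.memLp_fun.sub h'.memLp_fun
  memLp_grad := h.memLp_grad.sub h'.memLp_grad
  tangent := by
    filter_upwards [h.tangent, h'.tangent] with x hx hx'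
    rw [← surfTransfer_self] at hx hx' ⊢
    rw [Pi.sub_apply, map_sub, hx, hx']
  weak e he α η hη hs hse := by
    have := hφ.isFiniteMeasure_areaMeasure
    have i1 := hφ.integrableOn_mul_fderiv he (h.memLp_fun.integrable one_le_two) hη hs hse
      (EuclideanSpace.single α 1)
    have i2 := hφ.integrableOn_mul_fderiv he (h'.memLp_fun.integrable one_le_two) hη hs hse
      (EuclideanSpace.single α 1)
    have j1 := hφ.integrableOn_inner_covBasis_mul he (h.memLp_grad.integrable one_le_two)
      hη hs hse α
    have j2 := hφ.integrableOn_inner_covBasis_mul he (h'.memLp_grad.integrable one_le_two)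
      hη hs hse α
    simp only [Pi.sub_apply, sub_mul, inner_sub_left]
    rw [integral_sub i1 i2, integral_sub j1 j2, h.weak e he α η hη hs hse,
      h'.weak e he α η hη hs hse]
    ring

/-- The space `H¹` is the same for two immersions of the same surface; the gradients correspond
under the transfer operator, because the covariant components `∂_α u` do not involve the metric. -/
lemma transfer (hφ : IsImmersedC1 φ) (hφ' : IsImmersedC1 φ') (h : HasH1Grad φ u G) :
    HasH1Grad φ' u (fun x => surfTransfer φ φ' x (G x)) where
  memLp_fun := hφ.memLp_areaMeasure_of_memLp hφ' h.memLp_fun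
  memLp_grad := hφ.memLp_surfTransfer hφ' (hφ.memLp_areaMeasure_of_memLp hφ' h.memLp_grad)
  tangent := Eventually.of_forall fun x => by
    rw [← surfTransfer_self, hφ'.surfTransfer_surfTransfer]
  weak e he α η hη hs hse := by
    rw [h.weak e he α η hη hs hse]
    congr 1
    refine setIntegral_congr_fun e.open_target.measurableSet fun y hy => ?_
    simp only [hφ.inner_surfTransfer hφ' he (e.map_target hy)]

end HasH1Grad

/-- If two surfaces are close, the components of the displacement between them are functions in
`H¹`. The covariant components of the gradient of the `i`-th one are `eⁱ · a'_α - eⁱ · a_α`. -/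
lemma IsImmersedC1.hasH1Grad_displacement (hφ : IsImmersedC1 φ) (hφ' : IsImmersedC1 φ')
    (hsmall : ∀ x, ‖torusSub (φ' x) (φ x)‖ < 1) (i : Fin 3) :
    HasH1Grad φ (fun x => torusSub (φ' x) (φ x) i)
      (fun x => surfTransfer φ' φ x (EuclideanSpace.single i 1) -
        surfTransfer φ φ x (EuclideanSpace.single i 1)) := by
  have := hφ.isFiniteMeasure_areaMeasure
  have hder : ∀ e ∈ atlas E2 M, ∀ y ∈ e.target,
      HasFDerivAt (fun y => torusSub (φ' (e.symm y)) (φ (e.symm y)) i)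
        ((EuclideanSpace.proj i).comp (fderiv ℝ (lift φ' e (e.symm y)) y -
          fderiv ℝ (lift φ e (e.symm y)) y)) y := by
    intro e he y hy
    have hx := e.map_target hy
    have h1 := hasFDerivAt_displacement hx (hφ.differentiableAt e he _ hx)
      (hφ'.differentiableAt e he _ hx) (hsmall _)
    rw [e.right_inv hy] at h1
    exact (EuclideanSpace.proj (𝕜 := ℝ) i).hasFDerivAt.comp y h1
  have hcont : Continuous fun x => torusSub (φ' x) (φ x) i := by
    refine continuous_iff_continuousAt.2 fun x => ?_
    have hxs := mem_chart_source E2 x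
    have h1 := (hder _ (chart_mem_atlas E2 x) _ ((chartAt E2 x).map_source hxs)).continuousAt
    refine (h1.comp ((chartAt E2 x).continuousAt hxs)).congr ?_
    filter_upwards [(chartAt E2 x).open_source.mem_nhds hxs] with x' hx'
    simp [(chartAt E2 x).left_inv hx']
  refine ⟨?_, ?_, ?_, ?_⟩
  · refine MemLp.of_bound hcont.aestronglyMeasurable 1 (Eventually.of_forall fun x => ?_)
    exact (PiLp.norm_apply_le _ i).trans (hsmall x).le
  · exact (hφ'.memLp_surfTransfer hφ (memLp_const _)).sub
      (hφ.memLp_surfTransfer hφ (memLp_const _))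
  · refine Eventually.of_forall fun x => ?_
    rw [← surfTransfer_self, map_sub, hφ.surfTransfer_surfTransfer, hφ.surfTransfer_surfTransfer]
  · intro e he α η hη hs hse
    set v : E2 := EuclideanSpace.single α 1 with hv
    have hG : ∀ y ∈ e.target, fderiv ℝ (fun y => torusSub (φ' (e.symm y)) (φ (e.symm y)) i) y v =
        ⟪surfTransfer φ' φ (e.symm y) (EuclideanSpace.single i 1) -
          surfTransfer φ φ (e.symm y) (EuclideanSpace.single i 1),
          covBasis φ e (e.symm y) α⟫ := by
      intro y hy
      have hx := e.map_target hy
      rw [(hder e he y hy).fderiv, inner_sub_left, hφ'.inner_surfTransfer hφ he hx,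
        hφ.inner_surfTransfer hφ he hx, EuclideanSpace.inner_single_left,
        EuclideanSpace.inner_single_left]
      simp [covBasis, e.right_inv hy, hv]
    have hcs : ContinuousOn (fun y => torusSub (φ' (e.symm y)) (φ (e.symm y)) i) (tsupport η) :=
      hcont.comp_continuousOn (e.continuousOn_symm.mono hse)
    have hηd : Continuous fun y => fderiv ℝ η y v :=
      (hη.continuous_fderiv (by simp)).clm_apply continuous_const
    have hcd : ContinuousOn (fun y => fderiv ℝ
        (fun y => torusSub (φ' (e.symm y)) (φ (e.symm y)) i) y v) (tsupport η) := by
      have hc : ∀ ψ, IsImmersedC1 ψ → ContinuousOn (fun y => covBasis ψ e (e.symm y) α i)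
          (tsupport η) := fun ψ hψ =>
        (EuclideanSpace.proj (𝕜 := ℝ) i).continuous.comp_continuousOn
          ((hψ.continuousOn_covBasis e he α).comp (e.continuousOn_symm.mono hse)
            fun y hy => e.map_target (hse hy))
      refine ((hc φ' hφ').sub (hc φ hφ)).congr fun y hy => ?_
      rw [(hder e he y (hse hy)).fderiv]
      simp [covBasis, e.right_inv (hse hy), hv]
    have hint : ∀ g : E2 → ℝ, ContinuousOn g (tsupport η) → (∀ y ∉ tsupport η, g y = 0) →
        Integrable g := fun g hg h0 =>
      (hg.integrableOn_compact hs).integrable_of_forall_notMem_eq_zero h0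
    have hibp := integral_mul_fderiv_eq_neg_fderiv_mul_of_integrable (μ := volume)
      (f := fun y => torusSub (φ' (e.symm y)) (φ (e.symm y)) i) (g := η) (v := v)
      (hint _ (hcd.mul hη.continuous.continuousOn)
        fun y hy => by simp [image_eq_zero_of_notMem_tsupport hy])
      (hint _ (hcs.mul hηd.continuousOn)
        fun y hy => by simp [fderiv_apply_eq_zero_of_notMem_tsupport hy])
      (hint _ (hcs.mul hη.continuous.continuousOn)
        fun y hy => by simp [image_eq_zero_of_notMem_tsupport hy])
      (fun y hy => (hder e he y (hse hy)).differentiableAt)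
      (fun y _ => (hη.differentiable (by simp)) y)
    rw [setIntegral_eq_integral_of_forall_compl_eq_zero fun y hy => by
        rw [fderiv_apply_eq_zero_of_notMem_tsupport fun h => hy (hse h), mul_zero],
      hibp, neg_inj, ← setIntegral_eq_integral_of_forall_compl_eq_zero (s := e.target)
        fun y hy => by
          rw [image_eq_zero_of_notMem_tsupport fun h => hy (hse h), mul_zero]]
    exact setIntegral_congr_fun e.open_target.measurableSet fun y hy => by
      simp only [hG y hy]

end Sobolev

/-! ### Derivatives of the metric coefficients -/

section MatrixDerivative

variable {g : ℝ → Matrix (Fin 2) (Fin 2) ℝ} {b : Matrix (Fin 2) (Fin 2) ℝ} {v t₀ : ℝ}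

lemma hasDerivAt_det_of_entries
    (hg : ∀ α β, HasDerivAt (fun t => g t α β) (-(2 * v * b α β)) t₀) :
    HasDerivAt (fun t => (g t).det)
      (-(2 * v * (b 0 0 * g t₀ 1 1 + g t₀ 0 0 * b 1 1 - b 0 1 * g t₀ 1 0 - g t₀ 0 1 * b 1 0)))
      t₀ := by
  simp_rw [Matrix.det_fin_two]
  refine (((hg 0 0).mul (hg 1 1)).sub ((hg 0 1).mul (hg 1 0))).congr_deriv ?_
  ring

lemma trace_inv_mul_fin_two (A b : Matrix (Fin 2) (Fin 2) ℝ) :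
    (A⁻¹ * b).trace =
      A.det⁻¹ * (b 0 0 * A 1 1 + A 0 0 * b 1 1 - b 0 1 * A 1 0 - A 0 1 * b 1 0) := by
  rw [Matrix.inv_def, Ring.inverse_eq_inv', Matrix.trace_fin_two]
  simp only [Matrix.mul_apply, Fin.sum_univ_two, Matrix.smul_apply, Matrix.adjugate_fin_two,
    Matrix.of_apply, Matrix.cons_val_zero, Matrix.cons_val_one, smul_eq_mul]
  simp
  ring

/-- The area density of a metric with `ġ = -2 v b` has logarithmic derivative
`-v tr (g⁻¹ b)`. -/
lemma hasDerivAt_sqrt_det_div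
    (hg : ∀ α β, HasDerivAt (fun t => g t α β) (-(2 * v * b α β)) t₀)
    (hdet : 0 < (g t₀).det) :
    HasDerivAt (fun t => √(g t).det / √(g t₀).det)
      (-(2 * v * (1 / 2 * ((g t₀)⁻¹ * b).trace))) t₀ := by
  refine (((hasDerivAt_det_of_entries hg).sqrt hdet.ne').div_const _).congr_deriv ?_
  have hs := Real.sqrt_pos.2 hdet
  rw [trace_inv_mul_fin_two, div_div, mul_assoc 2 √_ √_, Real.mul_self_sqrt hdet.le]
  field_simp

lemma hasDerivAt_inv_of_entries
    (hg : ∀ α β, HasDerivAt (fun t => g t α β) (-(2 * v * b α β)) t₀)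
    (hdet : 0 < (g t₀).det) (α β : Fin 2) :
    HasDerivAt (fun t => (g t)⁻¹ α β) (2 * v * ((g t₀)⁻¹ * b * (g t₀)⁻¹) α β) t₀ := by
  have hd := (hasDerivAt_det_of_entries hg).inv hdet.ne'
  have hdne := hdet.ne'
  rw [Matrix.det_fin_two] at hdne
  simp only [Matrix.inv_def, Ring.inverse_eq_inv', Matrix.adjugate_fin_two, Matrix.smul_apply,
    smul_eq_mul, Matrix.mul_apply, Fin.sum_univ_two]
  fin_cases α <;> fin_cases β <;> simp
  · refine (hd.mul (hg 1 1)).congr_deriv ?_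
    simp only [Pi.inv_apply, Matrix.det_fin_two]
    field_simp
    ring
  · refine (hd.mul (hg 0 1)).neg.congr_deriv ?_
    simp only [Pi.inv_apply, Matrix.det_fin_two]
    field_simp
    ring
  · refine (hd.mul (hg 1 0)).neg.congr_deriv ?_
    simp only [Pi.inv_apply, Matrix.det_fin_two]
    field_simp
    ring
  · refine (hd.mul (hg 0 0)).congr_deriv ?_
    simp only [Pi.inv_apply, Matrix.det_fin_two]
    field_simp
    ring

lemma hasDerivAt_sqrt_det_div_mul_inv
    (hg : ∀ α β, HasDerivAt (fun t => g t α β) (-(2 * v * b α β)) t₀)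
    (hdet : 0 < (g t₀).det) (α β : Fin 2) :
    HasDerivAt (fun t => √(g t).det / √(g t₀).det * (g t)⁻¹ α β)
      (2 * v * (((g t₀)⁻¹ * b * (g t₀)⁻¹) α β -
        1 / 2 * ((g t₀)⁻¹ * b).trace * (g t₀)⁻¹ α β)) t₀ := by
  refine ((hasDerivAt_sqrt_det_div hg hdet).mul
    (hasDerivAt_inv_of_entries hg hdet α β)).congr_deriv ?_
  rw [div_self (Real.sqrt_pos.2 hdet).ne']
  ring

end MatrixDerivative

/-! ### The Dirichlet form of a surface, carried over to another one -/

/-- The density at `x`, with respect to the area of `φ`, of the Dirichlet form of the surface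
`φ'`: its arguments are vectors tangent to `φ`, standing for the vectors tangent to `φ'` with the
same covariant components. -/
def transferForm (φ φ' : M → T3) (x : M) (p q : E3) : ℝ :=
  areaRatio φ φ' x * ⟪surfTransfer φ φ' x p, surfTransfer φ φ' x q⟫

lemma transferForm_add_left (φ φ' : M → T3) (x : M) (p p' q : E3) :
    transferForm φ φ' x (p + p') q = transferForm φ φ' x p q + transferForm φ φ' x p' q := by
  simp only [transferForm, map_add, inner_add_left, mul_add]

lemma transferForm_sub_right (φ φ' : M → T3) (x : M) (p q q' : E3) :
    transferForm φ φ' x p (q - q') = transferForm φ φ' x p q - transferForm φ φ' x p q' := by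
  simp only [transferForm, map_sub, inner_sub_right, mul_sub]

lemma transferForm_comm (φ φ' : M → T3) (x : M) (p q : E3) :
    transferForm φ φ' x p q = transferForm φ φ' x q p := by
  simp only [transferForm, real_inner_comm]

lemma metric_eq_gram (φ : M → T3) (e : OpenPartialHomeomorph M E2) (x : M) :
    metric φ e x = Matrix.gram ℝ (covBasis φ e x) := rfl

lemma areaDensity_eq_sqrt (φ : M → T3) (e : OpenPartialHomeomorph M E2) (x : M) :
    areaDensity φ e x = √(Matrix.gram ℝ (covBasis φ e x)).det := rfl

namespace IsImmersedC1

variable [IsManifold 𝓘(ℝ, E2) ∞ M] {φ φ' : M → T3}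

lemma areaRatio_self (hφ : IsImmersedC1 φ) (x : M) : areaRatio φ φ x = 1 :=
  div_self (hφ.areaDensity_pos (chart_mem_atlas E2 x) (mem_chart_source E2 x)).ne'

lemma transferForm_eq (hφ : IsImmersedC1 φ) (hφ' : IsImmersedC1 φ')
    {e : OpenPartialHomeomorph M E2} (he : e ∈ atlas E2 M) {x : M} (hx : x ∈ e.source)
    (p q : E3) :
    transferForm φ φ' x p q = ∑ α, ∑ β, areaDensity φ' e x / areaDensity φ e x *
      (metric φ' e x)⁻¹ α β * ⟪p, covBasis φ e x α⟫ * ⟪q, covBasis φ e x β⟫ := by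
  rw [transferForm, hφ.areaRatio_eq hφ' he hx, hφ.surfTransfer_eq hφ' he hx,
    inner_frameTransfer_frameTransfer _ (hφ'.linearIndependent he hx), Finset.mul_sum]
  refine Finset.sum_congr rfl fun α _ => ?_
  rw [Finset.mul_sum]
  refine Finset.sum_congr rfl fun β _ => ?_
  rw [metric_eq_gram]
  ring

end IsImmersedC1

/-! ### Evolution of the metric -/

section Evolution

variable [IsManifold 𝓘(ℝ, E2) ∞ M] {Φ : ℝ → M → T3} {t₀ : ℝ} {n : M → E3} {v : M → ℝ}
  {e : OpenPartialHomeomorph M E2} {W : Set (ℝ × E2)} {F : ℝ × E2 → E3}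

lemma IsLocalLift.fderiv_time_eq (h : IsLocalLift Φ e W F)
    (hv : ∀ x, HasDerivAt (fun t => torusSub (Φ t x) (Φ t₀ x)) (v x • n x) t₀) {y : E2}
    (hz : (t₀, y) ∈ W) : fderiv ℝ F (t₀, y) (1, 0) = v (e.symm y) • n (e.symm y) := by
  have h1 : HasDerivAt (fun t => F (t, y)) (fderiv ℝ F (t₀, y) (1, 0)) t₀ :=
    (h.hasFDerivAt hz).comp_hasDerivAt t₀ ((hasDerivAt_id t₀).prodMk (hasDerivAt_const t₀ y))
  have h2 : (fun t => torusSub (Φ t (e.symm y)) (Φ t₀ (e.symm y))) =ᶠ[𝓝 t₀]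
      fun t => F (t, y) - F (t₀, y) := by
    have hc : ContinuousAt (fun t : ℝ => (t, y)) t₀ := by fun_prop
    filter_upwards [hc (h.eventually_torusSub_eq hz)] with t ht using ht.2
  exact ((h1.sub_const _).congr_of_eventuallyEq h2).unique (hv (e.symm y))

lemma IsLocalLift.inner_normal_covBasis (h : IsLocalLift Φ e W F) (he : e ∈ atlas E2 M)
    (hφ : IsImmersedC1 (Φ t₀)) (hn : IsUnitNormal (Φ t₀) n) {y : E2} (hz : (t₀, y) ∈ W)
    (α : Fin 2) : ⟪n (e.symm y), fderiv ℝ F (t₀, y) (0, EuclideanSpace.single α 1)⟫ = 0 := by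
  have hx := e.map_target (h.mem_target _ hz)
  have := h.covBasis_eq hz α
  dsimp only at this hx
  rw [← this, hφ.covBasis_eq he (chart_mem_atlas E2 _) hx (mem_chart_source E2 _), frameChange,
    inner_sum]
  refine Finset.sum_eq_zero fun β _ => ?_
  rw [real_inner_smul_right, real_inner_comm, (hn.2 (e.symm y)).2 β, mul_zero]

lemma IsLocalLift.isSymm (h : IsLocalLift Φ e W F) {z : ℝ × E2} (hz : z ∈ W) (a b : ℝ × E2) :
    fderiv ℝ (fderiv ℝ F) z a b = fderiv ℝ (fderiv ℝ F) z b a :=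
  ((h.contDiffAt hz).isSymmSndFDerivAt
    (by simpa using WithTop.coe_le_coe.2 (le_top : (2 : ℕ∞) ≤ ⊤))).eq a b

lemma IsLocalLift.secondForm_symm (h : IsLocalLift Φ e W F) {z : ℝ × E2} (hz : z ∈ W)
    (n : M → E3) (α β : Fin 2) :
    secondForm (Φ z.1) n e (e.symm z.2) α β = secondForm (Φ z.1) n e (e.symm z.2) β α := by
  rw [h.secondForm_eq hz, h.secondForm_eq hz, h.isSymm hz]

/-- Under a normal velocity `v n`, `∂_t a_α · a_β = -v b_αβ`: differentiate `v n · a_β = 0` along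
the surface. -/
lemma IsLocalLift.inner_fderiv_fderiv_time (h : IsLocalLift Φ e W F) (he : e ∈ atlas E2 M)
    (hφ : IsImmersedC1 (Φ t₀)) (hn : IsUnitNormal (Φ t₀) n)
    (hv : ∀ x, HasDerivAt (fun t => torusSub (Φ t x) (Φ t₀ x)) (v x • n x) t₀) {y : E2}
    (hz : (t₀, y) ∈ W) (α β : Fin 2) :
    ⟪fderiv ℝ (fderiv ℝ F) (t₀, y) (1, 0) (0, EuclideanSpace.single α 1),
      fderiv ℝ F (t₀, y) (0, EuclideanSpace.single β 1)⟫ =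
      -(v (e.symm y) * secondForm (Φ t₀) n e (e.symm y) α β) := by
  have hD : HasFDerivAt (fderiv ℝ F) (fderiv ℝ (fderiv ℝ F) (t₀, y)) (t₀, y) :=
    ((h.contDiffAt_fderiv hz).differentiableAt (by simp)).hasFDerivAt
  have hDs := hD.comp y (hasFDerivAt_prodMk_right t₀ y)
  have hV := hDs.clm_apply (hasFDerivAt_const (𝕜 := ℝ) ((1 : ℝ), (0 : E2)) y)
  have hA := hDs.clm_apply
    (hasFDerivAt_const (𝕜 := ℝ) ((0 : ℝ), EuclideanSpace.single β (1 : ℝ)) y)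
  have hVA := hV.inner ℝ hA
  have hzero : (fun y => ⟪fderiv ℝ F (t₀, y) (1, 0),
      fderiv ℝ F (t₀, y) (0, EuclideanSpace.single β 1)⟫) =ᶠ[𝓝 y] fun _ => (0 : ℝ) := by
    filter_upwards [h.eventually_slice_mem hz] with y' hy'
    rw [h.fderiv_time_eq hv hy', real_inner_smul_left, h.inner_normal_covBasis he hφ hn hy',
      mul_zero]
  have h0 := (hVA.congr_of_eventuallyEq hzero.symm).unique (hasFDerivAt_const (0 : ℝ) y)
  have h1 := congrArg (fun L : E2 →L[ℝ] ℝ => L (EuclideanSpace.single α 1)) h0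
  simp at h1
  have hsf := h.secondForm_eq hz n β α
  dsimp only at hsf
  have hss := h.secondForm_symm hz n α β
  dsimp only at hss
  rw [h.fderiv_time_eq hv hz, real_inner_smul_left, ← hsf, ← hss] at h1
  rw [h.isSymm hz]
  linarith

end Evolution

section EvolutionDerivative

variable [IsManifold 𝓘(ℝ, E2) ∞ M] {Φ : ℝ → M → T3} {J : Set ℝ} {t₀ : ℝ} {n : M → E3}
  {v : M → ℝ}

/-- Under a normal velocity `v n`, the first fundamental form satisfies `ȧ_αβ = -2 v b_αβ`. -/
lemma hasDerivAt_metric (hΦ : IsSurfaceEvolution Φ J) (ht₀ : t₀ ∈ J) (hn : IsUnitNormal (Φ t₀) n)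
    (hv : ∀ x, HasDerivAt (fun t => torusSub (Φ t x) (Φ t₀ x)) (v x • n x) t₀) (x : M)
    (α β : Fin 2) :
    HasDerivAt (fun t => metric (Φ t) (chartAt E2 x) x α β)
      (-(2 * v x * secondForm (Φ t₀) n (chartAt E2 x) x α β)) t₀ := by
  have he := chart_mem_atlas E2 x
  have hx := mem_chart_source E2 x
  obtain ⟨W, F, h, hz⟩ := hΦ.1.exists_isLocalLift he ht₀ hx
  set e := chartAt E2 x
  have hφ := hΦ.isImmersedC1 ht₀
  have hxy : e.symm (e x) = x := e.left_inv hx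
  have hcurve : HasDerivAt (fun t : ℝ => (t, e x)) (1, 0) t₀ :=
    (hasDerivAt_id t₀).prodMk (hasDerivAt_const t₀ (e x))
  have hcov : ∀ α, HasDerivAt (fun t => fderiv ℝ F (t, e x) (0, EuclideanSpace.single α 1))
      (fderiv ℝ (fderiv ℝ F) (t₀, e x) (1, 0) (0, EuclideanSpace.single α 1)) t₀ := by
    intro α
    have hD : HasFDerivAt (fderiv ℝ F) (fderiv ℝ (fderiv ℝ F) (t₀, e x)) (t₀, e x) :=
      ((h.contDiffAt_fderiv hz).differentiableAt (by simp)).hasFDerivAt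
    have hDt : HasDerivAt (fun t => fderiv ℝ F (t, e x))
        (fderiv ℝ (fderiv ℝ F) (t₀, e x) (1, 0)) t₀ := hD.comp_hasDerivAt t₀ hcurve
    exact (ContinuousLinearMap.apply ℝ E3
      ((0 : ℝ), EuclideanSpace.single α (1 : ℝ))).hasFDerivAt.comp_hasDerivAt t₀ hDt
  have hev : (fun t => metric (Φ t) e x α β) =ᶠ[𝓝 t₀] fun t =>
      ⟪fderiv ℝ F (t, e x) (0, EuclideanSpace.single α 1),
        fderiv ℝ F (t, e x) (0, EuclideanSpace.single β 1)⟫ := by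
    filter_upwards [hcurve.continuousAt (h.isOpen.mem_nhds hz)] with t ht
    have h1 := h.covBasis_eq ht
    simp only [hxy] at h1
    simp only [metric, Matrix.of_apply, h1]
  refine (((hcov α).inner ℝ (hcov β)).congr_of_eventuallyEq hev).congr_deriv ?_
  have h1 := h.inner_fderiv_fderiv_time he hφ hn hv hz
  have h2 := h.secondForm_symm hz n α β
  simp only [hxy] at h1 h2
  rw [h1, real_inner_comm, h1, ← h2]
  ring

lemma secondForm_symm (hΦ : IsSurfaceEvolution Φ J) (ht₀ : t₀ ∈ J) (n : M → E3) (x : M)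
    (α β : Fin 2) : secondForm (Φ t₀) n (chartAt E2 x) x α β =
      secondForm (Φ t₀) n (chartAt E2 x) x β α := by
  have hx := mem_chart_source E2 x
  obtain ⟨W, F, h, hz⟩ := hΦ.1.exists_isLocalLift (chart_mem_atlas E2 x) ht₀ hx
  have h2 := h.secondForm_symm hz n α β
  simp only [(chartAt E2 x).left_inv hx] at h2
  exact h2

lemma hasDerivAt_areaRatio (hΦ : IsSurfaceEvolution Φ J) (ht₀ : t₀ ∈ J)
    (hn : IsUnitNormal (Φ t₀) n)
    (hv : ∀ x, HasDerivAt (fun t => torusSub (Φ t x) (Φ t₀ x)) (v x • n x) t₀) (x : M) :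
    HasDerivAt (fun t => areaRatio (Φ t₀) (Φ t) x) (-(2 * v x * meanCurv (Φ t₀) n x)) t₀ :=
  hasDerivAt_sqrt_det_div (hasDerivAt_metric hΦ ht₀ hn hv x)
    (gram_det_pos ((hΦ.2 t₀ ht₀).2 x))

/-- The Dirichlet form of an evolving surface, for fixed covariant components, has the derivative
`2 v (b - H I)`: the term `b` comes from `a^{αβ}` and the term `-H I` from the area density. -/
lemma hasDerivAt_transferForm (hJ : IsOpen J) (hΦ : IsSurfaceEvolution Φ J) (ht₀ : t₀ ∈ J)
    (hn : IsUnitNormal (Φ t₀) n)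
    (hv : ∀ x, HasDerivAt (fun t => torusSub (Φ t x) (Φ t₀ x)) (v x • n x) t₀) (x : M)
    {p : E3} (hp : tangPart (Φ t₀) x p = p) (q : E3) :
    HasDerivAt (fun t => transferForm (Φ t₀) (Φ t) x p q)
      (2 * v x * ⟪secondFormOp (Φ t₀) n x p - meanCurv (Φ t₀) n x • p, q⟫) t₀ := by
  have he := chart_mem_atlas E2 x
  have hx := mem_chart_source E2 x
  have hφ := hΦ.isImmersedC1 ht₀
  have hLI := hφ.linearIndependent_chartAt x
  have hsymm := secondForm_symm hΦ ht₀ n x 1 0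
  have hc := fun α β => hasDerivAt_sqrt_det_div_mul_inv (hasDerivAt_metric hΦ ht₀ hn hv x)
    (gram_det_pos hLI) α β
  set e := chartAt E2 x
  have hev : (fun t => transferForm (Φ t₀) (Φ t) x p q) =ᶠ[𝓝 t₀] fun t => ∑ α, ∑ β,
      √(metric (Φ t) e x).det / √(metric (Φ t₀) e x).det * (metric (Φ t) e x)⁻¹ α β *
        ⟪p, covBasis (Φ t₀) e x α⟫ * ⟪q, covBasis (Φ t₀) e x β⟫ := by
    filter_upwards [hJ.mem_nhds ht₀] with t ht
    exact hφ.transferForm_eq (hΦ.isImmersedC1 ht) he hx p q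
  have hsum : HasDerivAt (fun t => ∑ α, ∑ β,
      √(metric (Φ t) e x).det / √(metric (Φ t₀) e x).det * (metric (Φ t) e x)⁻¹ α β *
        ⟪p, covBasis (Φ t₀) e x α⟫ * ⟪q, covBasis (Φ t₀) e x β⟫) _ t₀ :=
    HasDerivAt.fun_sum fun α _ => HasDerivAt.fun_sum fun β _ =>
      ((hc α β).mul_const _).mul_const _
  refine (hsum.congr_of_eventuallyEq hev).congr_deriv ?_
  have hgs := gram_inv_symm (covBasis (Φ t₀) e x) 1 0
  have hdual : ∀ (w : E3) (α : Fin 2), ⟪contraBasis (Φ t₀) e x α, w⟫ =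
      ∑ β, (metric (Φ t₀) e x)⁻¹ α β * ⟪w, covBasis (Φ t₀) e x β⟫ := by
    intro w α
    rw [contraBasis, sum_inner]
    exact Finset.sum_congr rfl fun β _ => by rw [real_inner_smul_left, real_inner_comm]
  have hpq : ⟪p, q⟫ = ∑ α, ⟪p, covBasis (Φ t₀) e x α⟫ * ⟪contraBasis (Φ t₀) e x α, q⟫ := by
    conv_lhs => rw [← hp]
    simp only [tangPart, sum_inner, real_inner_smul_left]
    rfl
  have hop : ⟪secondFormOp (Φ t₀) n x p, q⟫ = ∑ α, ∑ β, secondForm (Φ t₀) n e x α β *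
      ⟪contraBasis (Φ t₀) e x β, p⟫ * ⟪contraBasis (Φ t₀) e x α, q⟫ := by
    simp only [secondFormOp, sum_inner, real_inner_smul_left, real_inner_comm p]
    rfl
  have hH : meanCurv (Φ t₀) n x =
      1 / 2 * ((metric (Φ t₀) e x)⁻¹ * secondForm (Φ t₀) n e x).trace := rfl
  rw [inner_sub_left, real_inner_smul_left, hop, hpq, hH]
  rw [← metric_eq_gram] at hgs
  generalize ((metric (Φ t₀) e x)⁻¹ * secondForm (Φ t₀) n e x).trace = τ
  simp only [hdual, Fin.sum_univ_two, Matrix.mul_apply, hgs, hsymm]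
  ring

/-! ### Uniform estimates in time -/

/-- On a compact space, estimates near each point for times near `t₀` are uniform in space. -/
lemma exists_forall_of_forall_exists_nhds [CompactSpace M] {P : ℝ → ℝ × M → Prop}
    (hmono : ∀ K K' z, K ≤ K' → P K z → P K' z)
    (h : ∀ x : M, ∃ K, ∀ᶠ z in 𝓝 (t₀, x), P K z) :
    ∃ K, ∀ᶠ t in 𝓝 t₀, ∀ x, P K (t, x) := by
  have := isCompact_univ.induction_on (p := fun s : Set M => ∃ K, ∀ᶠ t in 𝓝 t₀, ∀ x ∈ s, P K (t, x))
    ⟨0, by simp⟩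
    (fun s s' hs ⟨K, hK⟩ => ⟨K, hK.mono fun t ht x hx => ht x (hs hx)⟩)
    (fun s s' ⟨K, hK⟩ ⟨K', hK'⟩ => ⟨max K K', by
      filter_upwards [hK, hK'] with t ht ht' x hx
      rcases hx with hx | hx
      · exact hmono _ _ _ (le_max_left _ _) (ht x hx)
      · exact hmono _ _ _ (le_max_right _ _) (ht' x hx)⟩)
    (fun x _ => by
      obtain ⟨K, hK⟩ := h x
      rw [nhds_prod_eq] at hK
      obtain ⟨pa, hpa, pb, hpb, hab⟩ := eventually_prod_iff.1 hK
      exact ⟨{x | pb x}, mem_nhdsWithin_of_mem_nhds hpb, K, hpa.mono fun t ht x hx => hab ht hx⟩)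
  simpa using this

lemma exists_nhds_abs_sub_le {f : ℝ × E2 → ℝ} {y : E2} (hf : ContDiffAt ℝ 1 f (t₀, y)) :
    ∃ K : ℝ, ∀ᶠ z in 𝓝 (t₀, y), |f z - f (t₀, z.2)| ≤ K * |z.1 - t₀| := by
  obtain ⟨K, S, hS, hL⟩ := hf.exists_lipschitzOnWith
  have hc : ContinuousAt (fun z : ℝ × E2 => (t₀, z.2)) (t₀, y) := by fun_prop
  refine ⟨K, ?_⟩
  filter_upwards [hS, hc hS] with z hz hz'
  have := hL.dist_le_mul z hz (t₀, z.2) hz'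
  simpa [Real.dist_eq, Prod.dist_eq] using this

/-- The bounds on an evolving surface at time `z.1` and position `z.2` used in the proof of
differentiability: Lipschitz bounds for the area density and for the Dirichlet form, and
smallness of the displacement. -/
structure EvolutionBound (Φ : ℝ → M → T3) (t₀ K : ℝ) (z : ℝ × M) : Prop where
  areaRatio_le : |areaRatio (Φ t₀) (Φ z.1) z.2 - 1| ≤ K * |z.1 - t₀|
  form_le : ∀ p q, |transferForm (Φ t₀) (Φ z.1) z.2 p q - transferForm (Φ t₀) (Φ t₀) z.2 p q| ≤
    K * |z.1 - t₀| * (‖p‖ * ‖q‖)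
  displacement_lt : ‖torusSub (Φ z.1 z.2) (Φ t₀ z.2)‖ < 1

lemma EvolutionBound.mono {K K' : ℝ} {z : ℝ × M} (hK : K ≤ K') (h : EvolutionBound Φ t₀ K z) :
    EvolutionBound Φ t₀ K' z where
  areaRatio_le := h.areaRatio_le.trans (by gcongr)
  form_le p q := (h.form_le p q).trans (by gcongr)
  displacement_lt := h.displacement_lt

lemma exists_nhds_evolutionBound (hJ : IsOpen J) (hΦ : IsSurfaceEvolution Φ J) (ht₀ : t₀ ∈ J)
    (x : M) : ∃ K, ∀ᶠ z in 𝓝 (t₀, x), EvolutionBound Φ t₀ K z := by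
  have he := chart_mem_atlas E2 x
  have hx := mem_chart_source E2 x
  obtain ⟨W, F, h, hz⟩ := hΦ.1.exists_isLocalLift he ht₀ hx
  set e := chartAt E2 x
  have hφ := hΦ.isImmersedC1 ht₀
  have hxy : e.symm (e x) = x := e.left_inv hx
  -- the covariant basis, the metric and its inverse as smooth functions of time and coordinates
  set a : ℝ × E2 → Fin 2 → E3 := fun z α => fderiv ℝ F z (0, EuclideanSpace.single α 1) with ha
  have ha_eq : ∀ z ∈ W, covBasis (Φ z.1) e (e.symm z.2) = a z := fun z hz =>
    funext fun α => h.covBasis_eq hz α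
  have hstill : ContDiffAt ℝ 1 (fun z : ℝ × E2 => (t₀, z.2)) (t₀, e x) := by fun_prop
  have hca : ∀ α, ContDiffAt ℝ 1 (fun z => a z α) (t₀, e x) := fun α =>
    ((h.contDiffAt_fderiv hz).of_le (by simp)).clm_apply contDiffAt_const
  have hcg : ∀ α β, ContDiffAt ℝ 1 (fun z => Matrix.gram ℝ (a z) α β) (t₀, e x) := fun α β =>
    (hca α).inner ℝ (hca β)
  have hcdet : ContDiffAt ℝ 1 (fun z => (Matrix.gram ℝ (a z)).det) (t₀, e x) := by
    simp_rw [Matrix.det_fin_two]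
    exact ((hcg 0 0).mul (hcg 1 1)).sub ((hcg 0 1).mul (hcg 1 0))
  have hpos : 0 < (Matrix.gram ℝ (a (t₀, e x))).det := by
    rw [← ha_eq _ hz]
    simp only [hxy]
    exact gram_det_pos (hφ.linearIndependent_chartAt x)
  have hcinv : ∀ α β, ContDiffAt ℝ 1 (fun z => (Matrix.gram ℝ (a z))⁻¹ α β) (t₀, e x) := by
    intro α β
    have hd := hcdet.inv hpos.ne'
    simp only [Matrix.inv_def, Ring.inverse_eq_inv', Matrix.adjugate_fin_two, Matrix.smul_apply,
      smul_eq_mul]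
    fin_cases α <;> fin_cases β <;> simp [-Matrix.gram_apply]
    · exact hd.mul (hcg 1 1)
    · exact (hd.mul (hcg 0 1)).neg
    · exact (hd.mul (hcg 1 0)).neg
    · exact hd.mul (hcg 0 0)
  set r : ℝ × E2 → ℝ := fun z =>
    √(Matrix.gram ℝ (a z)).det / √(Matrix.gram ℝ (a (t₀, z.2))).det with hr
  have hcs := hcdet.sqrt hpos.ne'
  have hcr : ContDiffAt ℝ 1 r (t₀, e x) :=
    hcs.div (ContDiffAt.comp (t₀, e x) (g := fun z => √(Matrix.gram ℝ (a z)).det)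
      (f := fun z : ℝ × E2 => (t₀, z.2)) hcs hstill) (Real.sqrt_pos.2 hpos).ne'
  obtain ⟨K₁, hK₁⟩ := exists_nhds_abs_sub_le hcr
  choose K₂ hK₂ using fun α β => exists_nhds_abs_sub_le (hcr.mul (hcinv α β))
  -- the covariant base vectors are bounded near the given point
  have hbd : ∀ α, ∀ᶠ z in 𝓝 (t₀, e x), ‖a (t₀, z.2) α‖ < ‖a (t₀, e x) α‖ + 1 := by
    intro α
    have hc : ContinuousAt (fun z : ℝ × E2 => a (t₀, z.2) α) (t₀, e x) :=
      ContinuousAt.comp (g := fun z => a z α) (f := fun z : ℝ × E2 => (t₀, z.2)) (x := (t₀, e x))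
        (hca α).continuousAt hstill.continuousAt
    exact hc.norm.eventually_lt continuousAt_const (by simp)
  set B : Fin 2 → ℝ := fun α => ‖a (t₀, e x) α‖ + 1 with hB
  have hcoord : ContinuousAt (fun z : ℝ × M => (z.1, e z.2)) (t₀, x) :=
    continuousAt_fst.prodMk
      ((e.continuousAt hx).comp (f := Prod.snd) (x := (t₀, x)) continuousAt_snd)
  have hstillc := hstill.continuousAt
  have key : ∀ᶠ z : ℝ × E2 in 𝓝 (t₀, e x), z ∈ W ∧ (t₀, z.2) ∈ W ∧
      |r z - r (t₀, z.2)| ≤ K₁ * |z.1 - t₀| ∧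
      (∀ α β, |r z * (Matrix.gram ℝ (a z))⁻¹ α β -
        r (t₀, z.2) * (Matrix.gram ℝ (a (t₀, z.2)))⁻¹ α β| ≤ K₂ α β * |z.1 - t₀|) ∧
      (∀ α, ‖a (t₀, z.2) α‖ < B α) ∧
      ‖torusSub (Φ z.1 (e.symm z.2)) (Φ t₀ (e.symm z.2))‖ < 1 := by
    filter_upwards [h.isOpen.mem_nhds hz, hstillc (h.isOpen.mem_nhds hz), hK₁,
      eventually_all.2 fun α => eventually_all.2 fun β => hK₂ α β, eventually_all.2 hbd,
      h.eventually_torusSub_eq hz] with z h1 h2 h3 h4 h5 h6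
    refine ⟨h1, h2, h3, h4, h5, ?_⟩
    rw [h6.2]
    exact h6.1.trans (by norm_num)
  refine ⟨max K₁ (∑ α, ∑ β, |K₂ α β| * (B α * B β)), ?_⟩
  have hJ' : ∀ᶠ z : ℝ × M in 𝓝 (t₀, x), z.1 ∈ J :=
    continuousAt_fst (hJ.mem_nhds ht₀)
  have hsrc : ∀ᶠ z : ℝ × M in 𝓝 (t₀, x), z.2 ∈ e.source :=
    continuousAt_snd (e.open_source.mem_nhds hx)
  filter_upwards [hcoord.eventually key, hJ', hsrc] with z ⟨h1, h2, h3, h4, h5, h6⟩ hzJ hzs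
  have hzx : e.symm (e z.2) = z.2 := e.left_inv hzs
  have hφ' := hΦ.isImmersedC1 hzJ
  have a1 := ha_eq _ h1
  have a2 := ha_eq _ h2
  simp only [hzx] at a1 a2 h6
  have hr1 : r (t₀, e z.2) = 1 := by
    simp only [hr]
    rw [← a2]
    exact div_self (hφ.areaDensity_pos he hzs).ne'
  refine ⟨?_, fun p q => ?_, h6⟩
  · rw [hφ.areaRatio_eq hφ' he hzs, areaDensity_eq_sqrt, areaDensity_eq_sqrt, a1, a2]
    rw [hr1] at h3
    exact h3.trans (by gcongr; exact le_max_left _ _)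
  · have hform : transferForm (Φ t₀) (Φ z.1) z.2 p q - transferForm (Φ t₀) (Φ t₀) z.2 p q =
        ∑ α, ∑ β, (r (z.1, e z.2) * (Matrix.gram ℝ (a (z.1, e z.2)))⁻¹ α β -
          r (t₀, e z.2) * (Matrix.gram ℝ (a (t₀, e z.2)))⁻¹ α β) *
            ⟪p, a (t₀, e z.2) α⟫ * ⟪q, a (t₀, e z.2) β⟫ := by
      rw [hφ.transferForm_eq hφ' he hzs, hφ.transferForm_eq hφ he hzs]
      simp only [areaDensity_eq_sqrt, metric_eq_gram, a1, a2, hr]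
      rw [← Finset.sum_sub_distrib]
      refine Finset.sum_congr rfl fun α _ => ?_
      rw [← Finset.sum_sub_distrib]
      refine Finset.sum_congr rfl fun β _ => ?_
      ring
    rw [hform]
    have hin : ∀ (w : E3) α, |⟪w, a (t₀, e z.2) α⟫| ≤ ‖w‖ * B α := fun w α =>
      (abs_real_inner_le_norm _ _).trans (by gcongr; exact (h5 α).le)
    have hB0 : ∀ α, 0 ≤ B α := fun α => by positivity
    calc _ ≤ ∑ α, ∑ β, (|K₂ α β| * |z.1 - t₀|) * (‖p‖ * B α) * (‖q‖ * B β) := by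
          refine (Finset.abs_sum_le_sum_abs _ _).trans (Finset.sum_le_sum fun α _ => ?_)
          refine (Finset.abs_sum_le_sum_abs _ _).trans (Finset.sum_le_sum fun β _ => ?_)
          rw [abs_mul, abs_mul]
          have := hB0 α
          gcongr
          · exact (h4 α β).trans (by gcongr; exact le_abs_self _)
          · exact hin p α
          · exact hin q β
      _ = (∑ α, ∑ β, |K₂ α β| * (B α * B β)) * |z.1 - t₀| * (‖p‖ * ‖q‖) := by
          simp only [Finset.sum_mul]
          refine Finset.sum_congr rfl fun α _ => Finset.sum_congr rfl fun β _ => ?_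
          ring
      _ ≤ _ := by gcongr; exact le_max_right _ _

lemma exists_evolutionBound [CompactSpace M] (hJ : IsOpen J) (hΦ : IsSurfaceEvolution Φ J)
    (ht₀ : t₀ ∈ J) :
    ∃ K, 0 ≤ K ∧ ∀ᶠ t in 𝓝 t₀, ∀ x, EvolutionBound Φ t₀ K (t, x) := by
  obtain ⟨K, hK⟩ := exists_forall_of_forall_exists_nhds (P := EvolutionBound Φ t₀)
    (fun _ _ _ h => EvolutionBound.mono h) (exists_nhds_evolutionBound hJ hΦ ht₀)
  exact ⟨max K 0, le_max_right _ _, hK.mono fun t ht x => (ht x).mono (le_max_left _ _)⟩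

end EvolutionDerivative

/-! ### Differentiation under the integral sign -/

/-- Differentiation under the integral sign at a single point, from a Lipschitz estimate relative
to that point. The measurability of the derivative comes from that of the difference quotients. -/
lemma hasDerivAt_integral_of_eventually_abs_sub_le {X : Type*} [MeasurableSpace X]
    {μ : Measure X} {f : ℝ → X → ℝ} {f' bound : X → ℝ} {t₀ : ℝ}
    (hmeas : ∀ᶠ t in 𝓝 t₀, AEStronglyMeasurable (f t) μ) (hint : Integrable (f t₀) μ)
    (hlip : ∀ᶠ t in 𝓝 t₀, ∀ x, |f t x - f t₀ x| ≤ bound x * |t - t₀|)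
    (hbound : Integrable bound μ) (hdiff : ∀ᵐ x ∂μ, HasDerivAt (fun t => f t x) (f' x) t₀) :
    Integrable f' μ ∧ HasDerivAt (fun t => ∫ x, f t x ∂μ) (∫ x, f' x ∂μ) t₀ := by
  classical
  obtain ⟨s, hs, hs'⟩ := (hmeas.and hlip).exists_mem
  have hm : AEStronglyMeasurable f' μ := by
    refine aestronglyMeasurable_of_tendsto_ae (𝓝[≠] t₀)
      (f := fun t x => if t ∈ s then slope (fun t => f t x) t₀ t else 0) (fun t => ?_) ?_
    · by_cases ht : t ∈ s
      · simp only [ht, if_true]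
        exact ((hs' t ht).1.sub hint.1).const_smul (t - t₀)⁻¹
      · simp only [ht, if_false]
        exact aestronglyMeasurable_const
    · filter_upwards [hdiff] with x hx
      refine (hasDerivAt_iff_tendsto_slope.1 hx).congr' ?_
      filter_upwards [mem_nhdsWithin_of_mem_nhds hs] with t ht
      simp [ht]
  set L : ℝ →L[ℝ] ℝ →L[ℝ] ℝ := ContinuousLinearMap.smulRightL ℝ ℝ ℝ 1
  have key := hasFDerivAt_integral_of_dominated_loc_of_lip' (𝕜 := ℝ) (F := f)
    (F' := fun x => L (f' x)) hs (fun t ht => (hs' t ht).1) hint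
    (L.continuous.comp_aestronglyMeasurable hm)
    (Eventually.of_forall fun x t ht => (hs' t ht).2 x) hbound
    (hdiff.mono fun x hx => hx.hasFDerivAt)
  have hi : Integrable f' μ := by
    have := key.1.apply_continuousLinearMap (1 : ℝ)
    simpa [L] using this
  refine ⟨hi, ?_⟩
  have h2 := key.2.hasDerivAt
  rw [L.integral_comp_comm hi] at h2
  simpa [L] using h2

/-- A function bounded by a multiple of `(t - t₀)²` has derivative zero at `t₀`. -/
lemma hasDerivAt_zero_of_abs_le_sq {r : ℝ → ℝ} {C t₀ : ℝ}
    (h : ∀ᶠ t in 𝓝 t₀, |r t| ≤ C * (t - t₀) ^ 2) : HasDerivAt r 0 t₀ := by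
  have hO : r =O[𝓝 t₀] fun t => ‖t - t₀‖ ^ 2 :=
    Asymptotics.IsBigO.of_bound C (h.mono fun t ht => by simpa using ht)
  have := (hO.hasFDerivAt (𝕜 := ℝ) one_lt_two).hasDerivAt
  simpa using this

section Energy

variable [IsManifold 𝓘(ℝ, E2) ∞ M] [CompactSpace M] [T2Space M] [MeasurableSpace M]
  [BorelSpace M]

/-! ### Integrals of the Dirichlet form -/

namespace IsImmersedC1

variable {φ φ' : M → T3}

lemma integrable_transferForm (hφ : IsImmersedC1 φ) (hφ' : IsImmersedC1 φ') {μ : Measure M}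
    {p q : M → E3} (hp : MemLp p 2 μ) (hq : MemLp q 2 μ) :
    Integrable (fun x => transferForm φ φ' x (p x) (q x)) μ := by
  have hc := hφ.continuous_areaRatio hφ'
  obtain ⟨C, hC⟩ := isCompact_univ.exists_bound_of_continuousOn hc.continuousOn
  refine Integrable.bdd_mul (c := C) ?_ hc.aestronglyMeasurable
    (Eventually.of_forall fun x => hC x (mem_univ x))
  have hp' := hφ.memLp_surfTransfer hφ' hp
  have hq' := hφ.memLp_surfTransfer hφ' hq
  refine (hp'.norm.integrable_mul hq'.norm).mono' (hp'.1.inner hq'.1)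
    (Eventually.of_forall fun x => ?_)
  exact norm_inner_le_norm _ _

lemma integral_areaMeasure (hφ : IsImmersedC1 φ) (hφ' : IsImmersedC1 φ') (f : M → ℝ) :
    ∫ x, f x ∂(areaMeasure φ') = ∫ x, areaRatio φ φ' x * f x ∂(areaMeasure φ) := by
  rw [hφ.areaMeasure_eq_withDensity hφ', integral_withDensity_eq_integral_toReal_smul
    (hφ.continuous_areaRatio hφ').measurable.ennreal_ofReal (by simp)]
  refine integral_congr_ae (Eventually.of_forall fun x => ?_)
  simp [ENNReal.toReal_ofReal (hφ.areaRatio_pos hφ' x).le]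

lemma area_eq (hφ : IsImmersedC1 φ) (hφ' : IsImmersedC1 φ') :
    area φ' = ∫ x, areaRatio φ φ' x ∂(areaMeasure φ) := by
  have h := hφ.integral_areaMeasure hφ' fun _ => 1
  simpa [area] using h

lemma ae_areaMeasure (hφ : IsImmersedC1 φ) (hφ' : IsImmersedC1 φ') {p : M → Prop}
    (h : ∀ᵐ x ∂(areaMeasure φ'), p x) : ∀ᵐ x ∂(areaMeasure φ), p x := by
  rw [hφ'.areaMeasure_eq_withDensity hφ]
  exact (withDensity_absolutelyContinuous _ _).ae_le h

end IsImmersedC1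

lemma transferForm_self (φ : M → T3) (hφ : IsImmersedC1 φ) {x : M} {p : E3}
    (hp : tangPart φ x p = p) : transferForm φ φ x p p = ‖p‖ ^ 2 := by
  rw [transferForm, hφ.areaRatio_self, surfTransfer_self, hp, one_mul, real_inner_self_eq_norm_sq]

variable {Φ : ℝ → M → T3} {J : Set ℝ} {t₀ : ℝ} {n : M → E3} {v : M → ℝ}

/-- The quadratic estimate behind the sensitivity formula: if `P` and `Q` satisfy the cell
equations of `φ'` and `φ`, tested with `D = P - Q`, and the Dirichlet forms of the two surfaces
differ by at most `ε`, then `‖D‖² ≤ 2 ε² ‖Q‖²`. -/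
lemma integral_norm_sq_sub_le {φ φ' : M → T3} (hφ : IsImmersedC1 φ) (hφ' : IsImmersedC1 φ')
    {P Q : M → E3} (hP : MemLp P 2 (areaMeasure φ)) (hQ : MemLp Q 2 (areaMeasure φ))
    (hD : ∀ᵐ x ∂(areaMeasure φ), tangPart φ x (P x - Q x) = P x - Q x)
    (hPD : ∫ x, transferForm φ φ' x (P x) (P x - Q x) ∂(areaMeasure φ) = 0)
    (hQD : ∫ x, transferForm φ φ x (Q x) (P x - Q x) ∂(areaMeasure φ) = 0)
    {ε : ℝ} (hε0 : 0 ≤ ε) (hε : ε ≤ 1 / 4)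
    (hform : ∀ x p q, |transferForm φ φ' x p q - transferForm φ φ x p q| ≤ ε * (‖p‖ * ‖q‖)) :
    ∫ x, ‖P x - Q x‖ ^ 2 ∂(areaMeasure φ) ≤ 2 * ε ^ 2 * ∫ x, ‖Q x‖ ^ 2 ∂(areaMeasure φ) := by
  have hDm := hP.sub hQ
  have iPD := hφ.integrable_transferForm hφ' hP hDm
  have iPD' := hφ.integrable_transferForm hφ hP hDm
  have iQD' := hφ.integrable_transferForm hφ hQ hDm
  have iD := hDm.integrable_norm_pow (p := 2) two_ne_zero
  have iQ := hQ.integrable_norm_pow (p := 2) two_ne_zero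
  simp only [Pi.sub_apply] at iPD iPD' iQD' iD
  have hsq : ∫ x, ‖P x - Q x‖ ^ 2 ∂(areaMeasure φ) =
      ∫ x, (transferForm φ φ x (P x) (P x - Q x) - transferForm φ φ' x (P x) (P x - Q x))
        ∂(areaMeasure φ) := by
    rw [integral_sub iPD' iPD, hPD, sub_zero, ← sub_zero (∫ x, transferForm φ φ x (P x) _ ∂_),
      ← hQD, ← integral_sub iPD' iQD']
    refine integral_congr_ae (hD.mono fun x hx => ?_)
    have h1 := transferForm_self φ hφ hx
    have h2 := transferForm_add_left φ φ x (Q x) (P x - Q x) (P x - Q x)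
    rw [add_sub_cancel] at h2
    simp only
    linarith
  have hle : ∫ x, ‖P x - Q x‖ ^ 2 ∂(areaMeasure φ) ≤
      ∫ x, (ε ^ 2 * ‖Q x‖ ^ 2 + 1 / 2 * ‖P x - Q x‖ ^ 2) ∂(areaMeasure φ) := by
    rw [hsq]
    refine integral_mono (iPD'.sub iPD) ((iQ.const_mul _).add (iD.const_mul _)) fun x => ?_
    have h1 := (abs_le.1 (hform x (P x) (P x - Q x))).1
    have h2 : ‖P x‖ ≤ ‖Q x‖ + ‖P x - Q x‖ := by
      simpa using norm_add_le (Q x) (P x - Q x)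
    have h3 : ε * (‖P x‖ * ‖P x - Q x‖) ≤
        ε * ((‖Q x‖ + ‖P x - Q x‖) * ‖P x - Q x‖) := by gcongr
    have h4 : ε * ‖P x - Q x‖ ^ 2 ≤ 1 / 4 * ‖P x - Q x‖ ^ 2 := by gcongr
    -- Young's inequality `ε ‖Q‖ ‖D‖ ≤ ε² ‖Q‖² + ‖D‖² / 4`, so that `‖D‖²` can be absorbed
    have h5 := sq_nonneg (ε * ‖Q x‖ - 1 / 2 * ‖P x - Q x‖)
    simp only
    nlinarith
  rw [integral_add (iQ.const_mul _) (iD.const_mul _), integral_const_mul, integral_const_mul] at hle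
  linarith

/-- Differentiability of the energies of a family of fields `P t` which, on the surface at the
time `t`, are orthogonal to the differences `P t - Q`, when `Q` is so on the surface at the time
`t₀`. The fields `P t` need not be differentiable in `t`. -/
lemma hasDerivAt_integral_transferForm (hJ : IsOpen J) (hΦ : IsSurfaceEvolution Φ J)
    (ht₀ : t₀ ∈ J) (hn : IsUnitNormal (Φ t₀) n)
    (hv : ∀ x, HasDerivAt (fun t => torusSub (Φ t x) (Φ t₀ x)) (v x • n x) t₀) {ι : Type*}
    {P : ℝ → ι → M → E3} {Q : ι → M → E3}
    (hQ : ∀ i, MemLp (Q i) 2 (areaMeasure (Φ t₀)))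
    (hQt : ∀ i, ∀ᵐ x ∂(areaMeasure (Φ t₀)), tangPart (Φ t₀) x (Q i x) = Q i x)
    (hP : ∀ᶠ t in 𝓝 t₀, ∀ i, MemLp (P t i) 2 (areaMeasure (Φ t₀)))
    (hD : ∀ᶠ t in 𝓝 t₀, ∀ i, ∀ᵐ x ∂(areaMeasure (Φ t₀)),
      tangPart (Φ t₀) x (P t i x - Q i x) = P t i x - Q i x)
    (hPD : ∀ᶠ t in 𝓝 t₀, ∀ i j,
      ∫ x, transferForm (Φ t₀) (Φ t) x (P t i x) (P t j x - Q j x) ∂(areaMeasure (Φ t₀)) = 0)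
    (hQD : ∀ᶠ t in 𝓝 t₀, ∀ i j,
      ∫ x, transferForm (Φ t₀) (Φ t₀) x (Q i x) (P t j x - Q j x) ∂(areaMeasure (Φ t₀)) = 0)
    (i j : ι) :
    Integrable (fun x => 2 * v x *
      ⟪secondFormOp (Φ t₀) n x (Q i x) - meanCurv (Φ t₀) n x • Q i x, Q j x⟫)
        (areaMeasure (Φ t₀)) ∧
    HasDerivAt
      (fun t => ∫ x, transferForm (Φ t₀) (Φ t) x (P t i x) (P t j x) ∂(areaMeasure (Φ t₀)))
      (∫ x, 2 * v x * ⟪secondFormOp (Φ t₀) n x (Q i x) - meanCurv (Φ t₀) n x • Q i x, Q j x⟫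
        ∂(areaMeasure (Φ t₀))) t₀ := by
  have hφ := hΦ.isImmersedC1 ht₀
  obtain ⟨K, hK0, hK⟩ := exists_evolutionBound hJ hΦ ht₀
  set μ := areaMeasure (Φ t₀) with hμ
  have hJev : ∀ᶠ t in 𝓝 t₀, t ∈ J := hJ.mem_nhds ht₀
  have iQ : ∀ i, Integrable (fun x => ‖Q i x‖ ^ 2) μ := fun i =>
    (hQ i).integrable_norm_pow (p := 2) two_ne_zero
  -- the energy of the fixed fields `Q`
  obtain ⟨hint, hmain⟩ := hasDerivAt_integral_of_eventually_abs_sub_le (μ := μ)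
    (f := fun t x => transferForm (Φ t₀) (Φ t) x (Q i x) (Q j x))
    (bound := fun x => K * (‖Q i x‖ * ‖Q j x‖))
    (hJev.mono fun t ht => (hφ.integrable_transferForm (hΦ.isImmersedC1 ht) (hQ i) (hQ j)).1)
    (hφ.integrable_transferForm hφ (hQ i) (hQ j))
    (hK.mono fun t ht x => ((ht x).form_le (Q i x) (Q j x)).trans_eq (by ring))
    (((hQ i).norm.integrable_mul (hQ j).norm).const_mul K)
    ((hQt i).mono fun x hx => hasDerivAt_transferForm hJ hΦ ht₀ hn hv x hx (Q j x))
  refine ⟨hint, ?_⟩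
  -- the remainder is quadratic in `t - t₀`
  set r : ℝ → ℝ := fun t => ∫ x, (transferForm (Φ t₀) (Φ t) x (P t i x - Q i x) (Q j x) -
    transferForm (Φ t₀) (Φ t₀) x (P t i x - Q i x) (Q j x)) ∂μ with hr
  have hdecomp : (fun t => ∫ x, transferForm (Φ t₀) (Φ t) x (P t i x) (P t j x) ∂μ) =ᶠ[𝓝 t₀]
      fun t => (∫ x, transferForm (Φ t₀) (Φ t) x (Q i x) (Q j x) ∂μ) + r t := by
    filter_upwards [hJev, hP, hPD, hQD] with t htJ hPt hPDt hQDt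
    have hφ' := hΦ.isImmersedC1 htJ
    have i1 := hφ.integrable_transferForm hφ' (hPt i) (hPt j)
    have i2 := hφ.integrable_transferForm hφ' (hPt i) ((hPt j).sub (hQ j))
    have i3 := hφ.integrable_transferForm hφ' (hQ i) (hQ j)
    have i4 := hφ.integrable_transferForm hφ' ((hPt i).sub (hQ i)) (hQ j)
    have i5 := hφ.integrable_transferForm hφ ((hPt i).sub (hQ i)) (hQ j)
    simp only [Pi.sub_apply] at i2 i4 i5
    have h0 : ∫ x, transferForm (Φ t₀) (Φ t₀) x (P t i x - Q i x) (Q j x) ∂μ = 0 := by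
      simp_rw [transferForm_comm _ _ _ _ (Q j _)]
      exact hQDt j i
    rw [hr]
    simp only
    rw [integral_sub i4 i5, h0, sub_zero, ← integral_add i3 i4,
      ← sub_zero (∫ x, transferForm (Φ t₀) (Φ t) x (P t i x) (P t j x) ∂μ), ← hPDt i j,
      ← integral_sub i1 i2]
    refine integral_congr_ae (Eventually.of_forall fun x => ?_)
    simp only
    rw [← transferForm_sub_right, sub_sub_cancel, ← transferForm_add_left, add_sub_cancel]
  have hrem : HasDerivAt r 0 t₀ := by
    have hsmall : ∀ᶠ t in 𝓝 t₀, K * |t - t₀| ≤ 1 / 4 := by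
      have hc : ContinuousAt (fun t => K * |t - t₀|) t₀ := by fun_prop
      exact (hc.eventually_lt continuousAt_const (by simp)).mono fun t ht => ht.le
    refine hasDerivAt_zero_of_abs_le_sq
      (C := K * (K ^ 2 * (∫ x, ‖Q i x‖ ^ 2 ∂μ) + 1 / 2 * ∫ x, ‖Q j x‖ ^ 2 ∂μ)) ?_
    filter_upwards [hJev, hK, hP, hD, hPD, hQD, hsmall] with t htJ hKt hPt hDt hPDt hQDt hst
    have hφ' := hΦ.isImmersedC1 htJ
    have hN := integral_norm_sq_sub_le hφ hφ' (hPt i) (hQ i) (hDt i) (hPDt i i) (hQDt i i)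
      (by positivity) hst fun x => (hKt x).form_le
    have iD := ((hPt i).sub (hQ i)).integrable_norm_pow (p := 2) two_ne_zero
    simp only [Pi.sub_apply] at iD
    have hdom : Integrable (fun x => K * (1 / 2 * ‖P t i x - Q i x‖ ^ 2 +
        1 / 2 * (t - t₀) ^ 2 * ‖Q j x‖ ^ 2)) μ :=
      ((iD.const_mul _).add ((iQ j).const_mul _)).const_mul K
    have hle := norm_integral_le_of_norm_le (f := fun x =>
      transferForm (Φ t₀) (Φ t) x (P t i x - Q i x) (Q j x) -
        transferForm (Φ t₀) (Φ t₀) x (P t i x - Q i x) (Q j x))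
          hdom (Eventually.of_forall fun x => by
      refine ((hKt x).form_le (P t i x - Q i x) (Q j x)).trans ?_
      have h5 := sq_nonneg (‖P t i x - Q i x‖ - |t - t₀| * ‖Q j x‖)
      rw [mul_assoc]
      refine mul_le_mul_of_nonneg_left ?_ hK0
      rw [sub_sq, mul_pow, sq_abs] at h5
      linarith)
    rw [integral_const_mul, integral_add (iD.const_mul _) ((iQ j).const_mul _),
      integral_const_mul, integral_const_mul] at hle
    refine hle.trans ?_
    have : (K * |t - t₀|) ^ 2 = K ^ 2 * (t - t₀) ^ 2 := by rw [mul_pow, sq_abs]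
    rw [this] at hN
    calc _ ≤ K * ((K ^ 2 * (∫ x, ‖Q i x‖ ^ 2 ∂μ) + 1 / 2 * ∫ x, ‖Q j x‖ ^ 2 ∂μ) *
          (t - t₀) ^ 2) := mul_le_mul_of_nonneg_left (by linarith) hK0
      _ = _ := by ring
  have hsum := (hmain.add hrem).congr_of_eventuallyEq hdecomp
  rwa [add_zero] at hsum

end Energy

variable [IsManifold 𝓘(ℝ, E2) ∞ M] [CompactSpace M] [T2Space M] [MeasurableSpace M] [BorelSpace M]

/-! ### Sensitivity of the area and of the cell energies -/

section CellField

variable {φ φ' : M → T3}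

lemma memLp_cellField (hφ : IsImmersedC1 φ) {p : E3} {u : M → ℝ} {G : M → E3}
    (hu : IsCellSolution φ p u G) (i : Fin 3) : MemLp (cellField φ G i) 2 (areaMeasure φ) := by
  have := hφ.isFiniteMeasure_areaMeasure
  exact hu.1.memLp_grad.add (hφ.memLp_tangPart _)

lemma tangPart_cellField (hφ : IsImmersedC1 φ) {p : E3} {u : M → ℝ} {G : M → E3}
    (hu : IsCellSolution φ p u G) (i : Fin 3) :
    ∀ᵐ x ∂(areaMeasure φ), tangPart φ x (cellField φ G i x) = cellField φ G i x := by
  filter_upwards [hu.1.tangent] with x hx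
  simp only [cellField, ← surfTransfer_self] at hx ⊢
  rw [map_add, hx, hφ.surfTransfer_surfTransfer]

/-- The energy of two tangent fields of the surface `φ'`, computed on `φ`. -/
lemma integral_inner_eq_transferForm (hφ : IsImmersedC1 φ) (hφ' : IsImmersedC1 φ') {p q : M → E3}
    (hp : ∀ᵐ x ∂(areaMeasure φ'), tangPart φ' x (p x) = p x)
    (hq : ∀ᵐ x ∂(areaMeasure φ'), tangPart φ' x (q x) = q x) :
    ∫ x, ⟪p x, q x⟫ ∂(areaMeasure φ') =
      ∫ x, transferForm φ φ' x (surfTransfer φ' φ x (p x)) (surfTransfer φ' φ x (q x))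
        ∂(areaMeasure φ) := by
  rw [hφ.integral_areaMeasure hφ']
  refine integral_congr_ae ?_
  filter_upwards [hφ.ae_areaMeasure hφ' hp, hφ.ae_areaMeasure hφ' hq] with x hx hx'
  simp only [transferForm, hφ.surfTransfer_surfTransfer, surfTransfer_self, hx, hx']

/-- The difference between the cell fields of two close surfaces, in terms of covariant
components, is the gradient of a function in `H¹`: the classes of the closed forms `dxⁱ` on the
two surfaces agree. -/
lemma hasH1Grad_cellField_sub (hφ : IsImmersedC1 φ) (hφ' : IsImmersedC1 φ')
    (hsmall : ∀ x, ‖torusSub (φ' x) (φ x)‖ < 1) {i : Fin 3} {u u' : M → ℝ} {G G' : M → E3}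
    (hu : HasH1Grad φ u G) (hu' : HasH1Grad φ' u' G') :
    ∃ w, HasH1Grad φ w fun x => surfTransfer φ' φ x (cellField φ' G' i x) - cellField φ G i x := by
  refine ⟨u' - (u - fun x => torusSub (φ' x) (φ x) i), ?_⟩
  convert (hu'.transfer hφ' hφ).sub hφ
    (hu.sub hφ (hφ.hasH1Grad_displacement hφ' hsmall i)) using 1
  funext x
  simp only [Pi.sub_apply, cellField, map_add, ← surfTransfer_self,
    hφ'.surfTransfer_surfTransfer]
  abel

/-- The cell equation of the surface `φ'`, tested with a function given on `φ`. -/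
lemma integral_transferForm_cellField_eq_zero (hφ : IsImmersedC1 φ) (hφ' : IsImmersedC1 φ')
    {i : Fin 3} {u w : M → ℝ} {G K : M → E3}
    (hu : IsCellSolution φ' (EuclideanSpace.single i 1) u G) (hw : HasH1Grad φ w K) :
    ∫ x, transferForm φ φ' x (surfTransfer φ' φ x (cellField φ' G i x)) (K x)
      ∂(areaMeasure φ) = 0 := by
  have hK := hw.transfer hφ hφ'
  rw [← hu.2 w _ hK]
  refine Eq.symm ((integral_inner_eq_transferForm hφ hφ' (tangPart_cellField hφ' hu i)
    hK.tangent).trans (integral_congr_ae (hw.tangent.mono fun x hx => ?_)))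
  simp only [hφ'.surfTransfer_surfTransfer, surfTransfer_self, hx]

end CellField

variable {Φ : ℝ → M → T3} {J : Set ℝ} {t₀ : ℝ} {n : M → E3} {v : M → ℝ}

lemma hasDerivAt_area (hJ : IsOpen J) (hΦ : IsSurfaceEvolution Φ J) (ht₀ : t₀ ∈ J)
    (hn : IsUnitNormal (Φ t₀) n)
    (hv : ∀ x, HasDerivAt (fun t => torusSub (Φ t x) (Φ t₀ x)) (v x • n x) t₀) :
    Integrable (fun x => 2 * v x * meanCurv (Φ t₀) n x) (areaMeasure (Φ t₀)) ∧
    HasDerivAt (fun t => area (Φ t))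
      (-∫ x, 2 * v x * meanCurv (Φ t₀) n x ∂(areaMeasure (Φ t₀))) t₀ := by
  have hφ := hΦ.isImmersedC1 ht₀
  have := hφ.isFiniteMeasure_areaMeasure
  obtain ⟨K, -, hK⟩ := exists_evolutionBound hJ hΦ ht₀
  have hJev : ∀ᶠ t in 𝓝 t₀, t ∈ J := hJ.mem_nhds ht₀
  obtain ⟨hint, hder⟩ := hasDerivAt_integral_of_eventually_abs_sub_le
    (μ := areaMeasure (Φ t₀)) (f := fun t x => areaRatio (Φ t₀) (Φ t) x) (bound := fun _ => K)
    (hJev.mono fun t ht =>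
      (hφ.continuous_areaRatio (hΦ.isImmersedC1 ht)).aestronglyMeasurable)
    (by simp only [hφ.areaRatio_self]; exact integrable_const 1)
    (hK.mono fun t ht x => by rw [hφ.areaRatio_self]; exact (ht x).areaRatio_le)
    (integrable_const K)
    (Eventually.of_forall fun x => hasDerivAt_areaRatio hΦ ht₀ hn hv x)
  refine ⟨by simpa using hint.neg, ?_⟩
  rw [integral_neg] at hder
  exact hder.congr_of_eventuallyEq (hJev.mono fun t ht => hφ.area_eq (hΦ.isImmersedC1 ht))

lemma hasDerivAt_adcIntegral (κ : ℝ) (hJ : IsOpen J) (hΦ : IsSurfaceEvolution Φ J) (ht₀ : t₀ ∈ J)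
    (hn : IsUnitNormal (Φ t₀) n)
    (hv : ∀ x, HasDerivAt (fun t => torusSub (Φ t x) (Φ t₀ x)) (v x • n x) t₀)
    {u : ℝ → Fin 3 → M → ℝ} {G : ℝ → Fin 3 → M → E3}
    (hu : ∀ t ∈ J, ∀ i, IsCellSolution (Φ t) (EuclideanSpace.single i 1) (u t i) (G t i))
    (i j : Fin 3) :
    Integrable (sensIntegrand κ (Φ t₀) n v (G t₀) i j) (areaMeasure (Φ t₀)) ∧
    HasDerivAt (fun t => adcIntegral κ (Φ t) (G t) i j)
      (∫ x, sensIntegrand κ (Φ t₀) n v (G t₀) i j x ∂(areaMeasure (Φ t₀))) t₀ := by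
  have hφ := hΦ.isImmersedC1 ht₀
  obtain ⟨K, -, hK⟩ := exists_evolutionBound hJ hΦ ht₀
  have hJev : ∀ᶠ t in 𝓝 t₀, t ∈ J := hJ.mem_nhds ht₀
  set P : ℝ → Fin 3 → M → E3 := fun t i x =>
    surfTransfer (Φ t) (Φ t₀) x (cellField (Φ t) (G t i) i x) with hPdef
  have hdiff : ∀ᶠ t in 𝓝 t₀, ∀ i, ∃ w, HasH1Grad (Φ t₀) w fun x =>
      P t i x - cellField (Φ t₀) (G t₀ i) i x := by
    filter_upwards [hJev, hK] with t ht hKt i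
    exact hasH1Grad_cellField_sub hφ (hΦ.isImmersedC1 ht) (fun x => (hKt x).displacement_lt)
      (hu t₀ ht₀ i).1 (hu t ht i).1
  obtain ⟨hint, hder⟩ := hasDerivAt_integral_transferForm hJ hΦ ht₀ hn hv (P := P)
    (Q := fun i => cellField (Φ t₀) (G t₀ i) i)
    (fun i => memLp_cellField hφ (hu t₀ ht₀ i) i)
    (fun i => tangPart_cellField hφ (hu t₀ ht₀ i) i)
    (hJev.mono fun t ht i => (hΦ.isImmersedC1 ht).memLp_surfTransfer hφ
      ((hΦ.isImmersedC1 ht).memLp_areaMeasure_of_memLp hφ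
        (memLp_cellField (hΦ.isImmersedC1 ht) (hu t ht i) i)))
    (hdiff.mono fun t ht i => (ht i).choose_spec.tangent)
    (by
      filter_upwards [hJev, hdiff] with t ht hd i j
      exact integral_transferForm_cellField_eq_zero hφ (hΦ.isImmersedC1 ht) (hu t ht i)
        (hd j).choose_spec)
    (by
      filter_upwards [hdiff] with t hd i j
      rw [← integral_transferForm_cellField_eq_zero hφ hφ (hu t₀ ht₀ i) (hd j).choose_spec]
      refine integral_congr_ae ((tangPart_cellField hφ (hu t₀ ht₀ i) i).mono fun x hx => ?_)
      simp only [surfTransfer_self, hx])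
    i j
  have hsens : sensIntegrand κ (Φ t₀) n v (G t₀) i j = fun x => κ * (2 * v x *
      ⟪secondFormOp (Φ t₀) n x (cellField (Φ t₀) (G t₀ i) i x) -
        meanCurv (Φ t₀) n x • cellField (Φ t₀) (G t₀ i) i x,
        cellField (Φ t₀) (G t₀ j) j x⟫) := by
    funext x
    rw [sensIntegrand]
    ring
  have hadc : (fun t => adcIntegral κ (Φ t) (G t) i j) =ᶠ[𝓝 t₀] fun t => κ *
      ∫ x, transferForm (Φ t₀) (Φ t) x (P t i x) (P t j x) ∂(areaMeasure (Φ t₀)) := by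
    filter_upwards [hJev] with t ht
    have hφ' := hΦ.isImmersedC1 ht
    rw [adcIntegral, integral_const_mul, integral_inner_eq_transferForm hφ hφ'
      (tangPart_cellField hφ' (hu t ht i) i) (tangPart_cellField hφ' (hu t ht j) j)]
  rw [hsens, integral_const_mul]
  exact ⟨hint.const_mul κ, (hder.const_mul κ).congr_of_eventuallyEq hadc⟩

lemma areaMeasure_eq_zero_of_area_eq_zero {φ φ' : M → T3} (hφ : IsImmersedC1 φ)
    (hφ' : IsImmersedC1 φ') (h : area φ = 0) : areaMeasure φ' = 0 := by
  have := hφ.isFiniteMeasure_areaMeasure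
  have h0 : areaMeasure φ = 0 := by
    rw [← Measure.measure_univ_eq_zero]
    exact (measureReal_eq_zero_iff (measure_ne_top _ _)).1 h
  rw [hφ.areaMeasure_eq_withDensity hφ', h0, withDensity_zero_left]

lemma hasDerivAt_adcMatrix (κ : ℝ) (hJ : IsOpen J) (hΦ : IsSurfaceEvolution Φ J) (ht₀ : t₀ ∈ J)
    {G : ℝ → Fin 3 → M → E3} {A' I' : ℝ} {i j : Fin 3}
    (hA : HasDerivAt (fun t => area (Φ t)) A' t₀)
    (hI : HasDerivAt (fun t => adcIntegral κ (Φ t) (G t) i j) I' t₀) :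
    HasDerivAt (fun t => adcMatrix κ (Φ t) (G t) i j)
      (I' / area (Φ t₀) - adcIntegral κ (Φ t₀) (G t₀) i j * A' / area (Φ t₀) ^ 2) t₀ := by
  have heq : (fun t => adcMatrix κ (Φ t) (G t) i j) = fun t =>
      adcIntegral κ (Φ t) (G t) i j / area (Φ t) := by
    funext t
    rw [adcMatrix, Matrix.of_apply]
    ring
  rw [heq]
  by_cases h : area (Φ t₀) = 0
  · -- on an empty surface all quantities vanish, and division by zero gives zero
    have hφ := hΦ.isImmersedC1 ht₀
    have hz : (fun t => adcIntegral κ (Φ t) (G t) i j / area (Φ t)) =ᶠ[𝓝 t₀] fun _ => 0 := by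
      filter_upwards [hJ.mem_nhds ht₀] with t ht
      have h0 := areaMeasure_eq_zero_of_area_eq_zero hφ (hΦ.isImmersedC1 ht) h
      simp [area, h0]
    rw [h]
    simpa using (hasDerivAt_const t₀ (0 : ℝ)).congr_of_eventuallyEq hz
  · refine (hI.div hA h).congr_deriv ?_
    field_simp

end ShellADC

end

open ShellADC
theorem proposition2 {M : Type*} [TopologicalSpace M] [ChartedSpace E2 M]
    [IsManifold 𝓘(ℝ, E2) ∞ M] [CompactSpace M] [T2Space M] [MeasurableSpace M] [BorelSpace M]
    (κ : ℝ) (J : Set ℝ) (hJ : IsOpen J) (t₀ : ℝ) (ht₀ : t₀ ∈ J)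
    (Φ : ℝ → M → T3) (hΦ : IsSurfaceEvolution Φ J)
    (n : M → E3) (hn : IsUnitNormal (Φ t₀) n)
    (v : M → ℝ) (hv : ∀ x, HasDerivAt (fun t => torusSub (Φ t x) (Φ t₀ x)) (v x • n x) t₀)
    (u : ℝ → Fin 3 → M → ℝ) (G : ℝ → Fin 3 → M → E3)
    (hu : ∀ t ∈ J, ∀ i, IsCellSolution (Φ t) (EuclideanSpace.single i 1) (u t i) (G t i)) :
    ∃ (A' : ℝ) (I' : Fin 3 → Fin 3 → ℝ),
      HasDerivAt (fun t => area (Φ t)) A' t₀ ∧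
      Integrable (fun x => 2 * v x * meanCurv (Φ t₀) n x) (areaMeasure (Φ t₀)) ∧
      A' = -∫ x, 2 * v x * meanCurv (Φ t₀) n x ∂(areaMeasure (Φ t₀)) ∧
      ∀ i j,
        HasDerivAt (fun t => adcIntegral κ (Φ t) (G t) i j) (I' i j) t₀ ∧
        Integrable (sensIntegrand κ (Φ t₀) n v (G t₀) i j) (areaMeasure (Φ t₀)) ∧
        I' i j = ∫ x, sensIntegrand κ (Φ t₀) n v (G t₀) i j x ∂(areaMeasure (Φ t₀)) ∧
        HasDerivAt (fun t => adcMatrix κ (Φ t) (G t) i j)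
          (I' i j / area (Φ t₀) -
            adcIntegral κ (Φ t₀) (G t₀) i j * A' / area (Φ t₀) ^ 2) t₀ := by
  obtain ⟨hHint, hA⟩ := hasDerivAt_area hJ hΦ ht₀ hn hv
  refine ⟨_, fun i j => ∫ x, sensIntegrand κ (Φ t₀) n v (G t₀) i j x ∂(areaMeasure (Φ t₀)),
    hA, hHint, rfl, fun i j => ?_⟩
  obtain ⟨hSint, hI⟩ := hasDerivAt_adcIntegral κ hJ hΦ ht₀ hn hv hu i j
  exact ⟨hI, hSint, rfl, hasDerivAt_adcMatrix κ hJ hΦ ht₀ hA hI⟩
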